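/- Let $d\ge 1$, let $\mu=(\mu_1,\dots,\mu_d)$ with all $\mu_i>0$, and write $|z|=z_1+\cdots+z_d$, $p=\mu/|\mu|$, and $P(x;\mu)=\prod_{i=1}^d e^{-\mu_i}\mu_i^{x_i}/x_i!$ for $x\in\mathbb Z_+^d$. Let $u=(u^{(0)},\dots,u^{(d-1)})$ be real functions on $\{1,\dots,d\}$ with $u^{(0)}\equiv1$ and $\sum_{i}u^{(r)}_iu^{(s)}_ip_i=\delta_{rs}a_r$, scaled so that at one point $e$ (say $e=d$) $u^{(r)}_e=1$ for every $r$. Suppose that $u$ has the hypergroup property $$\sum_{r=0}^{d-1}a_r^{-1}u^{(r)}_iu^{(r)}_ju^{(r)}_l\ \ge 0\qquad (1\le i,j,l\le d).$$ For $n=(n_0,\dots,n_{d-1})\in\mathbb Z_+^d$ let $n'=(n_1,\dots,n_{d-1})$ and $$C_n(x;\mu,u)=\frac{1}{n_0!}\,C_{n_0}\big(|x|-|n'|;|\mu|\big)\,|\mu|^{-|n'|}\,Q_{n'}(x;u),\qquad h_n=|\mu|^{|n|}\prod_{j=0}^{d-1}\frac{n_j!}{a_j^{n_j}},$$ where $C_m(t;\lambda)$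 is the one-dimensional Poisson–Charlier polynomial, $\sum_m C_m(t;\lambda)z^m/m!=e^z(1-z/\lambda)^t$, and $Q_{n'}(x;u)$ is the multivariate Krawtchouk polynomial, the coefficient of $\prod_{l=1}^{d-1}w_l^{n_l}$ in $\prod_{i=1}^d\big(1+\sum_{l=1}^{d-1}w_lu^{(l)}_i\big)^{x_i}$. Let $(\rho_n)_{n\in\mathbb Z_+^d}$ be real numbers with $\rho_0=1$, and consider the diagonal expansion $$f(x,y)=P(x;\mu)P(y;\mu)\Big\{1+\sum_{|n|\ge1}\rho_n h_n C_n(x;\mu,u)C_n(y;\mu,u)\Big\},\qquad x,y\in\mathbb Z_+^d .$$ Call $(\rho_n)$ representable if there is a random vector $\xi$ in the unit simplex $\{\xi\in\mathbb R^d:\xi_i\ge0,\ |\xi|\le1\}$ such that $$\rho_n=\mathbb E\Big[\prod_{j=0}^{d-1}\rho_j(\xi)^{n_j}\Big]\ \text{ for all } n\in\mathbb Z_+^d,\qquad \rho_j(\xi)=\sum_{i=1}^{d}u^{(j)}_i\xi_i .$$ Say that the expansion converges in mean square if for each $x$ the series converges in mean square with respect to $P(y;\mu)$ as a function of $y$,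 that is, $\sum_n\rho_n^2h_nC_n(x;\mu,u)^2<\infty$. Then: (a) The expansion converges in mean square and $f(x,y)\ge0$ for all $x,y$ if and only if $(\rho_n)$ is representable. (b) The following holds if and only if $(\rho_n)$ is representable: the series converges absolutely for all $x,y$, and $f$ is the probability function of a pair $(X,Y)$ with both marginals $P(\cdot;\mu)$ and $\mathbb E[C_m(X;\mu,u)C_n(Y;\mu,u)]=\delta_{mn}\rho_n/h_n$ for all $m,n$. (So under mean-square convergence non-negativity alone makes $f$ a proper bivariate Poisson distribution.) (c) Every bounded array $(\rho_n)$, in particular every correlation array ($|\rho_n|\le1$), gives an expansion that converges in mean square. -/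

import Mathlib

open scoped BigOperators
open MeasureTheory

noncomputable section

namespace PoissonLancaster

/-- The sum of the entries of a real vector. -/
def total {k : ℕ} (z : Fin (k + 1) → ℝ) : ℝ := ∑ i, z i

/-- The sum of the entries of a vector of counts, or of a multi-index. -/
def size {k : ℕ} (n : Fin k → ℕ) : ℕ := ∑ i, n i

/-- The probability vector `p = μ / |μ|`. -/
def prob {k : ℕ} (μ : Fin (k + 1) → ℝ) (i : Fin (k + 1)) : ℝ := μ i / total μ

/-- The squared norms `a_r = ∑ i, p_i (u_i^{(r)})^2`; here `u r i` stands for `u_i^{(r)}`. -/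
def sqNorm {k : ℕ} (p : Fin (k + 1) → ℝ) (u : Fin (k + 1) → Fin (k + 1) → ℝ)
    (r : Fin (k + 1)) : ℝ := ∑ i, u r i * u r i * p i

/-- `u` is a complete system of `d = k + 1` functions on `d` points that are orthogonal with
respect to `p`, contains the constant function `1` as `u^{(0)}`, and is scaled so that all the
functions take the value `1` at the point `e`. The squared norms are then positive when all `p_i`
are, so that the `d` functions form a basis. -/
structure IsOrthogonalBasis {k : ℕ} (p : Fin (k + 1) → ℝ)
    (u : Fin (k + 1) → Fin (k + 1) → ℝ) (e : Fin (k + 1)) : Prop where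
  zero_eq_one : ∀ i, u 0 i = 1
  orthogonal : ∀ r s, r ≠ s → ∑ i, u r i * u s i * p i = 0
  scaled : ∀ r, u r e = 1

/-- `𝔰(i, j, l) = ∑ r, a_r⁻¹ u_i^{(r)} u_j^{(r)} u_l^{(r)}`. -/
def tripleSum {k : ℕ} (p : Fin (k + 1) → ℝ) (u : Fin (k + 1) → Fin (k + 1) → ℝ)
    (i j l : Fin (k + 1)) : ℝ :=
  ∑ r, (sqNorm p u r)⁻¹ * u r i * u r j * u r l

/-- The hypergroup property of an orthogonal basis. -/
def HypergroupProperty {k : ℕ} (p : Fin (k + 1) → ℝ)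
    (u : Fin (k + 1) → Fin (k + 1) → ℝ) : Prop :=
  ∀ i j l, 0 ≤ tripleSum p u i j l

/-- The probability function of independent Poisson variables with means `μ_i`. -/
def poissonProb {k : ℕ} (μ : Fin (k + 1) → ℝ) (x : Fin (k + 1) → ℕ) : ℝ :=
  ∏ i, Real.exp (-μ i) * μ i ^ x i / (x i).factorial

/-- The one-dimensional Poisson–Charlier polynomial of degree `n` and parameter `c` at the real
point `t`: `n!` times the coefficient of `z^n` in `e^z (1 - z / c)^t`. -/
def charlier (n : ℕ) (t c : ℝ) : ℝ :=
  ∑ i ∈ Finset.range (n + 1),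
    (n.choose i : ℝ) * (-c⁻¹) ^ i * (descPochhammer ℝ i).eval t

/-- The multivariate Krawtchouk polynomial with index `m = (m_1, …, m_k)` at `x`: the coefficient
of `∏ w_l^{m_l}` in `∏ i, (1 + ∑ l, w_l u_i^{(l)})^{x_i}`, where `l` runs through `1, …, k`. -/
def krawtchouk {k : ℕ} (u : Fin (k + 1) → Fin (k + 1) → ℝ) (m : Fin k → ℕ)
    (x : Fin (k + 1) → ℕ) : ℝ :=
  MvPolynomial.coeff (Finsupp.equivFunOnFinite.symm m)
    (∏ i, (1 + ∑ l : Fin k,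
      MvPolynomial.C (u l.succ i) * (MvPolynomial.X l : MvPolynomial (Fin k) ℝ)) ^ x i)

/-- The multivariate Poisson–Charlier polynomial `C_n(x; μ, u)`, for `n = (n_0, n_1, …, n_k)`.
`Fin.tail n` is `(n_1, …, n_k)`. -/
def mvCharlier {k : ℕ} (μ : Fin (k + 1) → ℝ) (u : Fin (k + 1) → Fin (k + 1) → ℝ)
    (n x : Fin (k + 1) → ℕ) : ℝ :=
  ((n 0).factorial : ℝ)⁻¹
    * charlier (n 0) ((size x : ℝ) - (size (Fin.tail n) : ℝ)) (total μ)
    * (total μ ^ size (Fin.tail n))⁻¹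
    * krawtchouk u (Fin.tail n) x

/-- The reciprocal `h_n` of the mean square of `C_n`: `h_n = |μ|^{|n|} ∏ j, n_j! / a_j^{n_j}`. -/
def hCoeff {k : ℕ} (μ : Fin (k + 1) → ℝ) (u : Fin (k + 1) → Fin (k + 1) → ℝ)
    (n : Fin (k + 1) → ℕ) : ℝ :=
  total μ ^ size n * ∏ j, ((n j).factorial : ℝ) / sqNorm (prob μ) u j ^ n j

/-- The term with index `n` in the diagonal expansion. -/
def expansionTerm {k : ℕ} (μ : Fin (k + 1) → ℝ) (u : Fin (k + 1) → Fin (k + 1) → ℝ)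
    (ρ : (Fin (k + 1) → ℕ) → ℝ) (x y n : Fin (k + 1) → ℕ) : ℝ :=
  ρ n * hCoeff μ u n * mvCharlier μ u n x * mvCharlier μ u n y

/-- The diagonal expansion
`P(x; μ) P(y; μ) {1 + ∑_{|n| ≥ 1} ρ_n h_n C_n(x; μ, u) C_n(y; μ, u)}`. -/
def expansion {k : ℕ} (μ : Fin (k + 1) → ℝ) (u : Fin (k + 1) → Fin (k + 1) → ℝ)
    (ρ : (Fin (k + 1) → ℕ) → ℝ) (x y : Fin (k + 1) → ℕ) : ℝ :=
  poissonProb μ x * poissonProb μ y *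
    (1 + ∑' n : {n : Fin (k + 1) → ℕ // 1 ≤ size n}, expansionTerm μ u ρ x y n)

/-- For every `x`, the sum of the series `∑_n ρ_n h_n C_n(x) C_n(y)` exists in mean square with
respect to the Poisson distribution of `y`. As `h_n⁻¹` is the mean square of `C_n(y)` and distinct
`C_n` are orthogonal, this is the convergence of `∑_n ρ_n² h_n C_n(x)²`. -/
def ConvergesInMeanSquare {k : ℕ} (μ : Fin (k + 1) → ℝ) (u : Fin (k + 1) → Fin (k + 1) → ℝ)
    (ρ : (Fin (k + 1) → ℕ) → ℝ) : Prop :=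
  ∀ x : Fin (k + 1) → ℕ,
    Summable fun n : Fin (k + 1) → ℕ => ρ n ^ 2 * hCoeff μ u n * mvCharlier μ u n x ^ 2

/-- The diagonal expansion converges (absolutely) at every point, and is a bivariate probability
distribution with both marginals Poisson with mean vector `μ` and with
`E[C_m(X) C_n(Y)] = δ_{mn} ρ_n / h_n`. When `ρ_0 = 1`, the case `m = n = 0` of the last condition
says that the total mass is `1`. -/
structure IsBivariatePoisson {k : ℕ} (μ : Fin (k + 1) → ℝ)
    (u : Fin (k + 1) → Fin (k + 1) → ℝ) (ρ : (Fin (k + 1) → ℕ) → ℝ) : Prop where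
  summable : ∀ x y,
    Summable fun n : {n : Fin (k + 1) → ℕ // 1 ≤ size n} => expansionTerm μ u ρ x y n
  nonneg : ∀ x y, 0 ≤ expansion μ u ρ x y
  marginal_left : ∀ x, HasSum (fun y => expansion μ u ρ x y) (poissonProb μ x)
  marginal_right : ∀ y, HasSum (fun x => expansion μ u ρ x y) (poissonProb μ y)
  correlation : ∀ m n,
    HasSum (fun z : (Fin (k + 1) → ℕ) × (Fin (k + 1) → ℕ) =>
        mvCharlier μ u m z.1 * mvCharlier μ u n z.2 * expansion μ u ρ z.1 z.2)
      (if m = n then ρ n / hCoeff μ u n else 0)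

/-- The unit simplex: non-negative vectors `ξ` with `|ξ| ≤ 1`. -/
def unitSimplex (k : ℕ) : Set (Fin (k + 1) → ℝ) :=
  {ξ | (∀ i, 0 ≤ ξ i) ∧ total ξ ≤ 1}

/-- The linear forms `ρ_j(ξ) = ∑ i, u_i^{(j)} ξ_i`. -/
def linForm {k : ℕ} (u : Fin (k + 1) → Fin (k + 1) → ℝ) (j : Fin (k + 1))
    (ξ : Fin (k + 1) → ℝ) : ℝ := ∑ i, u j i * ξ i

/-- `ρ_n = E[∏ j, ρ_j(ξ)^{n_j}]` for all `n`, where `ξ` is a random vector in the unit simplex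
(given by its law `ν`). -/
def HasMomentRepresentation {k : ℕ} (u : Fin (k + 1) → Fin (k + 1) → ℝ)
    (ρ : (Fin (k + 1) → ℕ) → ℝ) : Prop :=
  ∃ ν : Measure (Fin (k + 1) → ℝ), IsProbabilityMeasure ν ∧
    (∀ᵐ ξ ∂ν, ξ ∈ unitSimplex k) ∧
    ∀ n : Fin (k + 1) → ℕ, ρ n = ∫ ξ, ∏ j, linForm u j ξ ^ n j ∂ν

end PoissonLancaster

end

open PoissonLancaster

noncomputable section

namespace PoissonLancaster

/-! Everything rests on one generating function, `hasSum_mvCharlier`: ∑ C_n(x) w^n = e^{w_0} ∏_i (1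
+ |μ|⁻¹ ∑_l ε_l w_l u_i^{(l)})^{x_i}, with ε_0 = -1 and ε_l = 1 otherwise. It is exponential in x,
so its Poisson expectations are explicit. Comparing coefficients gives the transform of C_n
(`hasSum_transform_mvCharlier`) and orthogonality with E[C_n²] = 1/h_n
(`hasSum_mvCharlier_mul_mvCharlier`). Bessel's inequality at a point mass gives ∑ h_n C_n(x)² < ∞,
hence (c). Under mean-square convergence the series may be integrated termwise, so every C_m is an
eigenfunction: ∑_y C_m(y) f(x,y) = P(x) ρ_m C_m(x). If f ≥ 0, the marginals and correlations follow.
Conversely, a bivariate Poisson distribution has |ρ_n| ≤ 1, hence mean-square convergence, so (b)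
reduces to (a).

Representable implies non-negative (`kernelSum_nonneg`): for a fixed ξ, the generating function in y
of P(y) ∑_n ρ_n h_n C_n(x) C_n(y) is a product of exponentials and powers of linear forms. The
hypergroup property makes all their coefficients non-negative. In probabilistic terms, given X = x
each of the x_i counts in cell i is independently deleted with probability 1 - |ξ| or moved to a
random cell, and independent Poisson counts with means (1 - |ξ|) μ_j are added. A general
representable array is a mixture over ξ.

Non-negative implies representable: the leading part of C_n(y) is a constant times ∏_l ρ_l(y)^{n_l},
and every ρ_l equals N + 1 at x = (N+1)e. If Y has the conditional law given X = x, the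
eigenfunction relation therefore yields E ∏_l ρ_l(Y/(N+1))^{n_l} → ρ_n (`tendsto_moment`). All
moments of |Y|/(N+1) have limits at most 1, so these laws are asymptotically carried by the simplex,
and compactness gives the law of ξ (`hasMomentRepresentation_of_tendsto`). -/

/-! ### Everywhere convergent power series in several variables. -/

theorem hasSum_congr_fun {ι : Type*} {f g : ι → ℝ} {a : ℝ} (h : ∀ i, f i = g i) :
    HasSum f a ↔ HasSum g a := by
  rw [funext h]

/-- The product of one-variable series is the series of products, for real series. -/
theorem hasSum_prod_pi {d : ℕ} {f : Fin d → ℕ → ℝ} {a : Fin d → ℝ}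
    (h : ∀ i, HasSum (f i) (a i)) :
    HasSum (fun n : Fin d → ℕ => ∏ i, f i (n i)) (∏ i, a i) := by
  induction d with
  | zero => simp
  | succ d ih =>
    have h1 := ih (fun i => h i.succ)
    have h2 := summable_mul_of_summable_norm (h 0).summable.norm h1.summable.norm
    have h3 := (h 0).mul h1 h2
    rw [Fin.prod_univ_succ, ← (Fin.consEquiv (fun _ : Fin (d + 1) => ℕ)).hasSum_iff]
    refine (hasSum_congr_fun fun x => ?_).2 h3
    simp [Fin.prod_univ_succ, Fin.consEquiv]

theorem coeff_eq_zero_of_hasSum_pow_zero {a : ℕ → ℝ}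
    (h : ∀ z : ℝ, HasSum (fun m => a m * z ^ m) 0) : a = 0 := by
  have h1 : HasFPowerSeriesAt (fun _ : ℝ => (0 : ℝ)) (FormalMultilinearSeries.ofScalars ℝ a) 0 := by
    rw [hasFPowerSeriesAt_iff]
    filter_upwards with z
    simpa [FormalMultilinearSeries.coeff_ofScalars, mul_comm] using h z
  have h2 := h1.eq_zero
  funext m
  have h3 : (FormalMultilinearSeries.ofScalars ℝ a).coeff m = 0 := by rw [h2]; rfl
  rwa [FormalMultilinearSeries.coeff_ofScalars] at h3

/-- A power series in `d` real variables that vanishes everywhere has zero coefficients. -/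
theorem coeff_eq_zero_of_hasSum_zero {d : ℕ} {b : (Fin d → ℕ) → ℝ}
    (h : ∀ w : Fin d → ℝ, HasSum (fun n => b n * ∏ i, w i ^ n i) 0) : b = 0 := by
  induction d with
  | zero =>
    funext n
    have := (hasSum_unique (fun n : Fin 0 → ℕ => b n * ∏ i, (0 : Fin 0 → ℝ) i ^ n i)).unique (h 0)
    rw [Finset.univ_eq_empty, Finset.prod_empty, mul_one] at this
    rw [Pi.zero_apply, ← this]
    exact congrArg b (Subsingleton.elim _ _)
  | succ d ih =>
    have key : ∀ (w : Fin d → ℝ) (z : ℝ), HasSum (fun q : ℕ × (Fin d → ℕ) =>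
        b (Fin.cons q.1 q.2) * (z ^ q.1 * ∏ i, w i ^ q.2 i)) 0 := by
      intro w z
      have := h (Fin.cons z w)
      rw [← (Fin.consEquiv (fun _ : Fin (d + 1) => ℕ)).hasSum_iff] at this
      refine (hasSum_congr_fun fun x => ?_).1 this
      simp [Fin.prod_univ_succ, Fin.consEquiv]
    have hs : ∀ (w : Fin d → ℝ) (m : ℕ),
        Summable fun n : Fin d → ℕ => b (Fin.cons m n) * ∏ i, w i ^ n i := by
      intro w m
      simpa using (key w 1).summable.prod_factor m
    -- For fixed `w`, the sums over the remaining indices are the coefficients of a power series in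
    -- the single variable `z` that vanishes identically.
    have h0 : ∀ w : Fin d → ℝ,
        (fun m => ∑' n : Fin d → ℕ, b (Fin.cons m n) * ∏ i, w i ^ n i) = 0 := by
      intro w
      refine coeff_eq_zero_of_hasSum_pow_zero fun z => ?_
      refine (key w z).prod_fiberwise fun m => ?_
      refine (hasSum_congr_fun fun n => ?_).2 ((hs w m).hasSum.mul_right (z ^ m))
      ring
    funext n
    have h1 := ih (b := fun n' => b (Fin.cons (n 0) n')) fun w => by
      have := (hs w (n 0)).hasSum
      rwa [show (∑' n' : Fin d → ℕ, b (Fin.cons (n 0) n') * ∏ i, w i ^ n' i) = 0 from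
        congrFun (h0 w) (n 0)] at this
    simpa using congrFun h1 (Fin.tail n)

/-- The device by which identities of generating functions become identities for expectations of the
C_n. -/
theorem coeff_unique {d : ℕ} {b c : (Fin d → ℕ) → ℝ} {F : (Fin d → ℝ) → ℝ}
    (hb : ∀ w, HasSum (fun n => b n * ∏ i, w i ^ n i) (F w))
    (hc : ∀ w, HasSum (fun n => c n * ∏ i, w i ^ n i) (F w)) : b = c := by
  have : (fun n => b n - c n) = 0 := coeff_eq_zero_of_hasSum_zero fun w => by
    simpa [sub_mul] using (hb w).sub (hc w)
  funext n
  exact sub_eq_zero.1 (congrFun this n)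

/-- `F` is the sum of a power series in `d` real variables with non-negative coefficients that
converges everywhere. -/
def HasNonnegExpansion {d : ℕ} (F : (Fin d → ℝ) → ℝ) : Prop :=
  ∃ b : (Fin d → ℕ) → ℝ, (∀ n, 0 ≤ b n) ∧ ∀ w, HasSum (fun n => b n * ∏ i, w i ^ n i) (F w)

/-- Terms sharing an exponent are collected over the fibres of `v`, so a product of two expansions
can be indexed by pairs. -/
theorem HasNonnegExpansion.of_family {d : ℕ} {F : (Fin d → ℝ) → ℝ} {ι : Type}
    (b : ι → ℝ) (v : ι → Fin d → ℕ) (hb : ∀ q, 0 ≤ b q)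
    (h : ∀ w, HasSum (fun q => b q * ∏ i, w i ^ v q i) (F w)) : HasNonnegExpansion F := by
  have hs : Summable b := by simpa using (h 1).summable
  have h1 : ∀ n, Summable fun q : {q // v q = n} => b q := fun n => hs.subtype _
  refine ⟨fun n => ∑' q : {q // v q = n}, b q, fun n => tsum_nonneg fun q => hb _, fun w => ?_⟩
  have h2 := h w
  rw [← (Equiv.sigmaFiberEquiv v).hasSum_iff] at h2
  refine h2.sigma fun n => ?_
  refine (hasSum_congr_fun fun q => ?_).2 ((h1 n).hasSum.mul_right (∏ i, w i ^ n i))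
  simp [Equiv.sigmaFiberEquiv, q.2]

theorem HasNonnegExpansion.mul {d : ℕ} {F G : (Fin d → ℝ) → ℝ} (hF : HasNonnegExpansion F)
    (hG : HasNonnegExpansion G) : HasNonnegExpansion fun w => F w * G w := by
  obtain ⟨b, hb, hF⟩ := hF
  obtain ⟨c, hc, hG⟩ := hG
  refine .of_family (ι := (Fin d → ℕ) × (Fin d → ℕ)) (fun q => b q.1 * c q.2)
    (fun q => q.1 + q.2) (fun q => mul_nonneg (hb _) (hc _)) fun w => ?_
  have h2 := summable_mul_of_summable_norm (hF w).summable.norm (hG w).summable.norm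
  refine (hasSum_congr_fun fun q => ?_).2 ((hF w).mul (hG w) h2)
  simp only [Pi.add_apply, pow_add, Finset.prod_mul_distrib]
  ring

theorem HasNonnegExpansion.add {d : ℕ} {F G : (Fin d → ℝ) → ℝ} (hF : HasNonnegExpansion F)
    (hG : HasNonnegExpansion G) : HasNonnegExpansion fun w => F w + G w := by
  obtain ⟨b, hb, hF⟩ := hF
  obtain ⟨c, hc, hG⟩ := hG
  exact ⟨fun n => b n + c n, fun n => add_nonneg (hb n) (hc n), fun w => by
    simpa [add_mul] using (hF w).add (hG w)⟩

theorem HasNonnegExpansion.const {d : ℕ} {c : ℝ} (hc : 0 ≤ c) :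
    HasNonnegExpansion fun _ : Fin d → ℝ => c :=
  .of_family (ι := Unit) (fun _ => c) (fun _ => 0) (fun _ => hc) fun w => by simp

theorem HasNonnegExpansion.coord {d : ℕ} (j : Fin d) :
    HasNonnegExpansion fun w : Fin d → ℝ => w j :=
  .of_family (ι := Unit) (fun _ => 1) (fun _ => Pi.single j 1) (fun _ => zero_le_one) fun w => by
    have : ∏ i, w i ^ (Pi.single j 1 : Fin d → ℕ) i = w j := by
      rw [Finset.prod_eq_single j] <;> simp +contextual
    simp [this]

theorem HasNonnegExpansion.exp_coord {d : ℕ} (j : Fin d) {c : ℝ} (hc : 0 ≤ c) :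
    HasNonnegExpansion fun w : Fin d → ℝ => Real.exp (c * w j) :=
  .of_family (fun m : ℕ => c ^ m / m.factorial) (fun m => Pi.single j m)
    (fun m => by positivity) fun w => by
    have (m : ℕ) : ∏ i, w i ^ (Pi.single j m : Fin d → ℕ) i = w j ^ m := by
      rw [Finset.prod_eq_single j] <;> simp +contextual
    have h := NormedSpace.expSeries_div_hasSum_exp (c * w j)
    rw [← Real.exp_eq_exp_ℝ] at h
    refine (hasSum_congr_fun fun m => ?_).2 h
    rw [this, mul_pow]
    ring

theorem HasNonnegExpansion.prod {d : ℕ} {ι : Type*} (s : Finset ι) {F : ι → (Fin d → ℝ) → ℝ}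
    (hF : ∀ i ∈ s, HasNonnegExpansion (F i)) : HasNonnegExpansion fun w => ∏ i ∈ s, F i w := by
  classical
  induction s using Finset.induction_on with
  | empty => simpa using HasNonnegExpansion.const zero_le_one
  | insert i s hi ih =>
    simp only [Finset.prod_insert hi]
    exact (hF i (by simp)).mul (ih fun j hj => hF j (by simp [hj]))

theorem HasNonnegExpansion.sum {d : ℕ} {ι : Type*} (s : Finset ι) {F : ι → (Fin d → ℝ) → ℝ}
    (hF : ∀ i ∈ s, HasNonnegExpansion (F i)) : HasNonnegExpansion fun w => ∑ i ∈ s, F i w := by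
  classical
  induction s using Finset.induction_on with
  | empty => simpa using HasNonnegExpansion.const le_rfl
  | insert i s hi ih =>
    simp only [Finset.sum_insert hi]
    exact (hF i (by simp)).add (ih fun j hj => hF j (by simp [hj]))

theorem HasNonnegExpansion.pow {d : ℕ} {F : (Fin d → ℝ) → ℝ} (hF : HasNonnegExpansion F)
    (m : ℕ) : HasNonnegExpansion fun w => F w ^ m := by
  simpa using HasNonnegExpansion.prod (Finset.range m) (F := fun _ => F) fun _ _ => hF

/-- The coefficients of any expansion of such a function are non-negative. -/
theorem HasNonnegExpansion.coeff_nonneg {d : ℕ} {F : (Fin d → ℝ) → ℝ}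
    (hF : HasNonnegExpansion F) {b : (Fin d → ℕ) → ℝ}
    (hb : ∀ w, HasSum (fun n => b n * ∏ i, w i ^ n i) (F w)) (n : Fin d → ℕ) : 0 ≤ b n := by
  obtain ⟨c, hc, h⟩ := hF
  rw [coeff_unique hb h]
  exact hc n

/-! ### Generating functions of the Krawtchouk and Charlier polynomials. -/

/-- The generating polynomial of the Krawtchouk polynomials. -/
def krawtchoukGen {k : ℕ} (v : Fin (k + 1) → Fin (k + 1) → ℝ) (x : Fin (k + 1) → ℕ) :
    MvPolynomial (Fin k) ℝ :=
  ∏ i, (1 + ∑ l : Fin k, MvPolynomial.C (v l.succ i) * MvPolynomial.X l) ^ x i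

theorem krawtchouk_eq_coeff {k : ℕ} (v : Fin (k + 1) → Fin (k + 1) → ℝ) (m : Fin k → ℕ)
    (x : Fin (k + 1) → ℕ) : krawtchouk v m x =
      MvPolynomial.coeff (Finsupp.equivFunOnFinite.symm m) (krawtchoukGen v x) := rfl

theorem totalDegree_krawtchoukGen_le {k : ℕ} (v : Fin (k + 1) → Fin (k + 1) → ℝ)
    (x : Fin (k + 1) → ℕ) : (krawtchoukGen v x).totalDegree ≤ size x := by
  refine (MvPolynomial.totalDegree_finsetProd _ _).trans (Finset.sum_le_sum fun i _ => ?_)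
  refine (MvPolynomial.totalDegree_pow _ _).trans ?_
  refine mul_le_of_le_one_right (Nat.zero_le _) ?_
  refine (MvPolynomial.totalDegree_add _ _).trans (max_le (by simp) ?_)
  refine MvPolynomial.totalDegree_finsetSum_le fun l _ => ?_
  refine (MvPolynomial.totalDegree_mul _ _).trans ?_
  simp

/-- The generating polynomial has degree at most |x|. This makes the truncated differences |x| - |m|
below harmless. -/
theorem krawtchouk_eq_zero {k : ℕ} (v : Fin (k + 1) → Fin (k + 1) → ℝ) {m : Fin k → ℕ}
    {x : Fin (k + 1) → ℕ} (h : size x < size m) : krawtchouk v m x = 0 := by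
  rw [krawtchouk_eq_coeff]
  refine MvPolynomial.coeff_eq_zero_of_totalDegree_lt
    ((totalDegree_krawtchoukGen_le v x).trans_lt (h.trans_le ?_))
  refine (Finset.sum_subset (Finset.subset_univ _) fun l _ hl => ?_).ge
  exact Finsupp.notMem_support_iff.1 hl

/-- The homogenized generating function of the Krawtchouk polynomials. -/
theorem exists_sum_krawtchouk {k : ℕ} (v : Fin (k + 1) → Fin (k + 1) → ℝ)
    (x : Fin (k + 1) → ℕ) : ∃ S : Finset (Fin k → ℕ), (∀ m ∉ S, krawtchouk v m x = 0) ∧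
      ∀ (z : ℝ) (w : Fin k → ℝ),
        ∑ m ∈ S, krawtchouk v m x * z ^ (size x - size m) * ∏ l, w l ^ m l
          = ∏ i, (z + ∑ l, w l * v l.succ i) ^ x i := by
  classical
  refine ⟨(krawtchoukGen v x).support.map Finsupp.equivFunOnFinite.toEmbedding, ?_, ?_⟩
  · intro m hm
    by_contra h
    exact hm (Finset.mem_map.2 ⟨Finsupp.equivFunOnFinite.symm m,
      MvPolynomial.mem_support_iff.2 h, by simp⟩)
  · intro z w
    rw [Finset.sum_map]
    have hcont : Continuous fun z : ℝ => ∑ m ∈ (krawtchoukGen v x).support,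
        krawtchouk v (Finsupp.equivFunOnFinite.toEmbedding m) x *
          z ^ (size x - size (Finsupp.equivFunOnFinite.toEmbedding m)) *
          ∏ l, w l ^ (Finsupp.equivFunOnFinite.toEmbedding m) l := by fun_prop
    have hcont' : Continuous fun z : ℝ => ∏ i, (z + ∑ l, w l * v l.succ i) ^ x i := by fun_prop
    -- Dehomogenizing by w/z needs z ≠ 0; the value z = 0 follows by continuity. It cannot be
    -- omitted, because z will be 1 + (s/c) w_0.
    refine congrFun (hcont.ext_on (dense_compl_singleton (0 : ℝ)) hcont' fun z hz => ?_) z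
    have hz : z ≠ 0 := hz
    have h1 : ∏ i, (z + ∑ l, w l * v l.succ i) ^ x i
        = z ^ size x * MvPolynomial.eval (fun l => w l / z) (krawtchoukGen v x) := by
      rw [size, ← Finset.prod_pow_eq_pow_sum, krawtchoukGen, map_prod, ← Finset.prod_mul_distrib]
      refine Finset.prod_congr rfl fun i _ => ?_
      rw [map_pow, ← mul_pow]
      congr 1
      simp only [map_add, map_one, map_sum, map_mul, MvPolynomial.eval_C, MvPolynomial.eval_X]
      rw [mul_add, mul_one, Finset.mul_sum]
      congr 1
      refine Finset.sum_congr rfl fun l _ => ?_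
      field_simp
    simp only
    rw [h1, MvPolynomial.eval_eq', Finset.mul_sum]
    refine Finset.sum_congr rfl fun m hm => ?_
    have hle : size (Finsupp.equivFunOnFinite m) ≤ size x := by
      by_contra hlt
      have := krawtchouk_eq_zero v (not_le.1 hlt)
      rw [krawtchouk_eq_coeff] at this
      exact MvPolynomial.mem_support_iff.1 hm (by simpa using this)
    have h2 : z ^ size x = z ^ (size x - size (Finsupp.equivFunOnFinite m)) * ∏ l, z ^ m l := by
      rw [Finset.prod_pow_eq_pow_sum, ← pow_add]
      congr 1
      exact (Nat.sub_add_cancel hle).symm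
    rw [krawtchouk_eq_coeff]
    simp only [Equiv.coe_toEmbedding, Equiv.symm_apply_apply, h2, div_pow,
      Finset.prod_div_distrib, Finsupp.equivFunOnFinite_apply]
    have h3 : ∏ l, z ^ m l ≠ 0 := Finset.prod_ne_zero_iff.2 fun l _ => pow_ne_zero _ hz
    field_simp

/-- The coefficient of `z ^ m` in `exp z * (1 + r * z) ^ N`. -/
def expBinomCoeff (r : ℝ) (N m : ℕ) : ℝ :=
  ∑ i ∈ Finset.range (m + 1), (N.choose i : ℝ) * r ^ i * ((m - i).factorial : ℝ)⁻¹

theorem hasSum_expBinomCoeff (r : ℝ) (N : ℕ) (z : ℝ) :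
    HasSum (fun m => expBinomCoeff r N m * z ^ m) (Real.exp z * (1 + r * z) ^ N) := by
  have h1 := NormedSpace.expSeries_div_hasSum_exp z
  rw [← Real.exp_eq_exp_ℝ] at h1
  have h2 : HasSum (fun i => (N.choose i : ℝ) * r ^ i * z ^ i) ((1 + r * z) ^ N) := by
    have h3 : (1 + r * z) ^ N
        = ∑ i ∈ Finset.range (N + 1), (N.choose i : ℝ) * r ^ i * z ^ i := by
      rw [add_comm, add_pow]
      refine Finset.sum_congr rfl fun i _ => ?_
      rw [mul_pow]
      ring
    rw [h3]
    refine hasSum_sum_of_ne_finset_zero fun i hi => ?_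
    rw [Nat.choose_eq_zero_of_lt (by simpa using hi)]
    simp
  have h4 := hasSum_sum_range_mul_of_summable_norm h2.summable.norm h1.summable.norm
  rw [h1.tsum_eq, h2.tsum_eq, mul_comm] at h4
  refine (hasSum_congr_fun fun m => ?_).2 h4
  rw [expBinomCoeff, Finset.sum_mul]
  refine Finset.sum_congr rfl fun i hi => ?_
  have : z ^ m = z ^ i * z ^ (m - i) := by
    rw [← pow_add, Nat.add_sub_cancel' (by simpa [Nat.lt_succ_iff] using hi)]
  rw [this]
  ring

/-- At a natural number the falling factorials are i! times binomial coefficients, which leaves the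
Cauchy product of e^z and (1 - z/c)^N. -/
theorem charlier_natCast (m N : ℕ) (c : ℝ) :
    (m.factorial : ℝ)⁻¹ * charlier m N c = expBinomCoeff (-c⁻¹) N m := by
  rw [charlier, expBinomCoeff, Finset.mul_sum]
  refine Finset.sum_congr rfl fun i hi => ?_
  have hi : i ≤ m := by simpa [Nat.lt_succ_iff] using hi
  rw [descPochhammer_eval_eq_descFactorial, Nat.descFactorial_eq_factorial_mul_choose,
    Nat.cast_choose ℝ hi]
  have h1 : (m.factorial : ℝ) ≠ 0 := by positivity
  have h2 : (i.factorial : ℝ) ≠ 0 := by positivity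
  push_cast
  field_simp

/-- The coefficients of
`exp w₀ * ∏ i, (1 + (s * w₀ + ∑ l, w_l * v_i^{(l)}) / c) ^ x_i`. -/
def genCoeff {k : ℕ} (c s : ℝ) (v : Fin (k + 1) → Fin (k + 1) → ℝ)
    (x n : Fin (k + 1) → ℕ) : ℝ :=
  expBinomCoeff (s / c) (size x - size (Fin.tail n)) (n 0) * (c ^ size (Fin.tail n))⁻¹
    * krawtchouk v (Fin.tail n) x

/-- Only finitely many values of the second index contribute, so no summability over pairs has to be
assumed. -/
theorem hasSum_prod_finset {α β : Type*} {f : α × β → ℝ} (S : Finset β) {a : β → ℝ}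
    (hS : ∀ m, ∀ n ∉ S, f (m, n) = 0) (h : ∀ n ∈ S, HasSum (fun m => f (m, n)) (a n)) :
    HasSum f (∑ n ∈ S, a n) := by
  classical
  have h1 : ∀ n ∈ S, HasSum (fun q : α × β => if q.2 = n then f q else 0) (a n) := by
    intro n hn
    have hinj : Function.Injective fun m : α => (m, n) := fun m m' h => by simpa using h
    rw [← hinj.hasSum_iff]
    · simpa [Function.comp_def] using h n hn
    · intro q hq
      rw [if_neg]
      rintro rfl
      exact hq ⟨q.1, rfl⟩
  refine (hasSum_congr_fun fun q => ?_).2 (hasSum_sum h1)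
  rw [Finset.sum_ite_eq]
  split_ifs with hq
  · rfl
  · exact hS q.1 q.2 hq

theorem hasSum_genCoeff {k : ℕ} (c s : ℝ)
    (v : Fin (k + 1) → Fin (k + 1) → ℝ) (x : Fin (k + 1) → ℕ) (w : Fin (k + 1) → ℝ) :
    HasSum (fun n => genCoeff c s v x n * ∏ l, w l ^ n l)
      (Real.exp (w 0) * ∏ i, (1 + (s * w 0 + ∑ l : Fin k, w l.succ * v l.succ i) / c) ^ x i) := by
  obtain ⟨S, hS, hsum⟩ := exists_sum_krawtchouk v x
  rw [← (Fin.consEquiv (fun _ : Fin (k + 1) => ℕ)).hasSum_iff]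
  -- The homogenized Krawtchouk identity at z = 1 + (s/c) w_0: the power |x| - |m| of z that
  -- accompanies each m is the binomial factor of the Charlier series in w_0.
  have hval : Real.exp (w 0) *
      ∏ i, (1 + (s * w 0 + ∑ l : Fin k, w l.succ * v l.succ i) / c) ^ x i
      = ∑ m ∈ S, Real.exp (w 0) * (1 + s / c * w 0) ^ (size x - size m) *
        ((c ^ size m)⁻¹ * krawtchouk v m x * ∏ l : Fin k, w l.succ ^ m l) := by
    have h1 := hsum (1 + s / c * w 0) (fun l => w l.succ / c)
    have h2 : ∏ i, (1 + (s * w 0 + ∑ l : Fin k, w l.succ * v l.succ i) / c) ^ x i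
        = ∏ i, ((1 + s / c * w 0) + ∑ l : Fin k, w l.succ / c * v l.succ i) ^ x i := by
      refine Finset.prod_congr rfl fun i _ => ?_
      congr 1
      rw [add_div, Finset.sum_div, ← add_assoc]
      congr 1
      · ring
      · exact Finset.sum_congr rfl fun l _ => by ring
    rw [h2, ← h1, Finset.mul_sum]
    refine Finset.sum_congr rfl fun m _ => ?_
    simp only [div_pow, Finset.prod_div_distrib, Finset.prod_pow_eq_pow_sum]
    rw [show ∑ l, m l = size m from rfl]
    ring
  rw [hval]
  refine hasSum_prod_finset S ?_ ?_
  · intro m n hn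
    simp [Fin.consEquiv, genCoeff, Fin.tail_def, hS n hn]
  · intro n _
    refine (hasSum_congr_fun fun m => ?_).2
      ((hasSum_expBinomCoeff (s / c) (size x - size n) (w 0)).mul_right _)
    simp only [Function.comp_apply, Fin.consEquiv, Equiv.coe_fn_mk, genCoeff, Fin.prod_univ_succ,
      Fin.cons_zero, Fin.cons_succ, Fin.tail_cons]
    ring

/-- The Charlier argument |x| - |n'| can be negative, but then the Krawtchouk factor is zero, so
truncated subtraction gives the same value. -/
theorem mvCharlier_eq_genCoeff {k : ℕ} (μ : Fin (k + 1) → ℝ)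
    (u : Fin (k + 1) → Fin (k + 1) → ℝ) (n x : Fin (k + 1) → ℕ) :
    mvCharlier μ u n x = genCoeff (total μ) (-1) u x n := by
  rw [mvCharlier, genCoeff]
  rcases lt_or_ge (size x) (size (Fin.tail n)) with h | h
  · simp [krawtchouk_eq_zero u h]
  · rw [← Nat.cast_sub h, charlier_natCast, neg_div, one_div]

/-- The sign `ε_l`: `-1` for `l = 0` and `1` for `l ≥ 1`. -/
def sgn {k : ℕ} (l : Fin (k + 1)) : ℝ := if l = 0 then -1 else 1

theorem sgn_mul_self {k : ℕ} (l : Fin (k + 1)) : sgn l * sgn l = 1 := by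
  rw [sgn]
  split_ifs <;> norm_num

/-- The generating function of the polynomials `C_n`. -/
theorem hasSum_mvCharlier {k : ℕ} (μ : Fin (k + 1) → ℝ)
    {u : Fin (k + 1) → Fin (k + 1) → ℝ} (hu : ∀ i, u 0 i = 1) (x : Fin (k + 1) → ℕ)
    (w : Fin (k + 1) → ℝ) :
    HasSum (fun n => mvCharlier μ u n x * ∏ l, w l ^ n l)
      (Real.exp (w 0) * ∏ i, (1 + (∑ l, sgn l * w l * u l i) / total μ) ^ x i) := by
  convert hasSum_genCoeff (total μ) (-1) u x w using 7 with n n i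
  · exact mvCharlier_eq_genCoeff μ u n x
  · simp [Fin.sum_univ_succ, sgn, hu]

/-! ### Majorants for the polynomials C_n. -/

/-- Coefficientwise domination of polynomials. -/
def CoeffDominated {σ : Type*} (p q : MvPolynomial σ ℝ) : Prop :=
  ∀ m, |p.coeff m| ≤ q.coeff m

theorem CoeffDominated.mul {σ : Type*} {p q p' q' : MvPolynomial σ ℝ} (h : CoeffDominated p q)
    (h' : CoeffDominated p' q') : CoeffDominated (p * p') (q * q') := by
  classical
  intro m
  rw [MvPolynomial.coeff_mul, MvPolynomial.coeff_mul]
  refine (Finset.abs_sum_le_sum_abs _ _).trans (Finset.sum_le_sum fun a _ => ?_)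
  rw [abs_mul]
  exact mul_le_mul (h _) (h' _) (abs_nonneg _) ((abs_nonneg _).trans (h _))

theorem CoeffDominated.one {σ : Type*} : CoeffDominated (1 : MvPolynomial σ ℝ) 1 := by
  classical
  intro m
  rw [MvPolynomial.coeff_one]
  split_ifs <;> simp

theorem CoeffDominated.pow {σ : Type*} {p q : MvPolynomial σ ℝ} (h : CoeffDominated p q) (m : ℕ) :
    CoeffDominated (p ^ m) (q ^ m) := by
  induction m with
  | zero => simpa using CoeffDominated.one
  | succ m ih => simpa [pow_succ] using ih.mul h

theorem CoeffDominated.add {σ : Type*} {p q p' q' : MvPolynomial σ ℝ} (h : CoeffDominated p q)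
    (h' : CoeffDominated p' q') : CoeffDominated (p + p') (q + q') := fun m => by
  rw [MvPolynomial.coeff_add, MvPolynomial.coeff_add]
  exact (abs_add_le _ _).trans (add_le_add (h m) (h' m))

theorem CoeffDominated.sum {σ ι : Type*} (s : Finset ι) {p q : ι → MvPolynomial σ ℝ}
    (h : ∀ i, CoeffDominated (p i) (q i)) : CoeffDominated (∑ i ∈ s, p i) (∑ i ∈ s, q i) := by
  intro m
  rw [MvPolynomial.coeff_sum, MvPolynomial.coeff_sum]
  exact (Finset.abs_sum_le_sum_abs _ _).trans (Finset.sum_le_sum fun a _ => h a m)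

theorem CoeffDominated.prod {σ ι : Type*} (s : Finset ι) {p q : ι → MvPolynomial σ ℝ}
    (h : ∀ i, CoeffDominated (p i) (q i)) : CoeffDominated (∏ i ∈ s, p i) (∏ i ∈ s, q i) := by
  classical
  induction s using Finset.induction_on with
  | empty => simpa using CoeffDominated.one
  | insert i s hi ih =>
    simp only [Finset.prod_insert hi]
    exact (h i).mul ih

theorem abs_krawtchouk_le {k : ℕ} (u : Fin (k + 1) → Fin (k + 1) → ℝ) (m : Fin k → ℕ)
    (x : Fin (k + 1) → ℕ) : |krawtchouk u m x| ≤ krawtchouk (fun l i => |u l i|) m x := by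
  classical
  refine CoeffDominated.prod _ (fun i => (CoeffDominated.one.add
    (CoeffDominated.sum _ fun l => ?_)).pow _) _
  intro m
  rw [MvPolynomial.coeff_C_mul, MvPolynomial.coeff_C_mul, abs_mul, MvPolynomial.coeff_X]
  split_ifs <;> simp

theorem expBinomCoeff_nonneg {r : ℝ} (hr : 0 ≤ r) (N m : ℕ) : 0 ≤ expBinomCoeff r N m :=
  Finset.sum_nonneg fun i _ => by positivity

theorem abs_expBinomCoeff_le (r : ℝ) (N m : ℕ) :
    |expBinomCoeff r N m| ≤ expBinomCoeff |r| N m := by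
  refine (Finset.abs_sum_le_sum_abs _ _).trans (Finset.sum_le_sum fun i _ => ?_)
  rw [abs_mul, abs_mul, abs_pow, Nat.abs_cast, abs_of_nonneg (by positivity : (0 : ℝ) ≤ _⁻¹)]

/-- A majorant of `|C_n(x)|`. -/
def charlierMajorant {k : ℕ} (μ : Fin (k + 1) → ℝ) (u : Fin (k + 1) → Fin (k + 1) → ℝ)
    (n x : Fin (k + 1) → ℕ) : ℝ :=
  genCoeff (total μ) 1 (fun l i => |u l i|) x n

/-- Taking absolute values of all data (the sign -1 and the u_i^{(l)}) keeps the form of the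
generating function, so the majorant is again summable with explicit sum. -/
theorem abs_mvCharlier_le {k : ℕ} {μ : Fin (k + 1) → ℝ} (hμ : 0 < total μ)
    (u : Fin (k + 1) → Fin (k + 1) → ℝ) (n x : Fin (k + 1) → ℕ) :
    |mvCharlier μ u n x| ≤ charlierMajorant μ u n x := by
  rw [mvCharlier_eq_genCoeff, charlierMajorant, genCoeff, genCoeff, abs_mul, abs_mul,
    abs_of_pos (by positivity : 0 < (total μ ^ size (Fin.tail n))⁻¹)]
  have h := abs_expBinomCoeff_le (-1 / total μ) (size x - size (Fin.tail n)) (n 0)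
  rw [abs_div, abs_neg, abs_one, abs_of_pos hμ] at h
  have h0 := expBinomCoeff_nonneg (one_div_pos.2 hμ).le (size x - size (Fin.tail n)) (n 0)
  gcongr
  exact abs_krawtchouk_le _ _ _

theorem hasSum_charlierMajorant {k : ℕ} (μ : Fin (k + 1) → ℝ)
    (u : Fin (k + 1) → Fin (k + 1) → ℝ) (x : Fin (k + 1) → ℕ) (w : Fin (k + 1) → ℝ) :
    HasSum (fun n => charlierMajorant μ u n x * ∏ l, w l ^ n l)
      (Real.exp (w 0) *
        ∏ i, (1 + (w 0 + ∑ l : Fin k, w l.succ * |u l.succ i|) / total μ) ^ x i) := by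
  simpa [charlierMajorant] using hasSum_genCoeff (total μ) 1 (fun l i => |u l i|) x w

/-! ### The Poisson weight, the basis, and functions of exponential growth. -/

theorem total_pos {k : ℕ} {μ : Fin (k + 1) → ℝ} (hμ : ∀ i, 0 < μ i) : 0 < total μ :=
  Finset.sum_pos (fun i _ => hμ i) Finset.univ_nonempty

theorem prob_pos {k : ℕ} {μ : Fin (k + 1) → ℝ} (hμ : ∀ i, 0 < μ i) (i : Fin (k + 1)) :
    0 < prob μ i := div_pos (hμ i) (total_pos hμ)

theorem total_mul_prob {k : ℕ} {μ : Fin (k + 1) → ℝ} (hμ : ∀ i, 0 < μ i) (i : Fin (k + 1)) :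
    total μ * prob μ i = μ i := mul_div_cancel₀ _ (total_pos hμ).ne'

theorem sum_prob {k : ℕ} {μ : Fin (k + 1) → ℝ} (hμ : ∀ i, 0 < μ i) : ∑ i, prob μ i = 1 := by
  simp only [prob]
  rw [← Finset.sum_div]
  exact div_self (total_pos hμ).ne'

section Basis

variable {k : ℕ} {p : Fin (k + 1) → ℝ} {u : Fin (k + 1) → Fin (k + 1) → ℝ} {e : Fin (k + 1)}

theorem IsOrthogonalBasis.sqNorm_pos (hu : IsOrthogonalBasis p u e) (hp : ∀ i, 0 < p i)
    (r : Fin (k + 1)) : 0 < sqNorm p u r := by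
  refine Finset.sum_pos' (fun i _ => mul_nonneg (mul_self_nonneg _) (hp i).le)
    ⟨e, Finset.mem_univ _, ?_⟩
  rw [hu.scaled]
  simpa using hp e

theorem IsOrthogonalBasis.sum_mul (hu : IsOrthogonalBasis p u e) (r s : Fin (k + 1)) :
    ∑ i, u r i * u s i * p i = if r = s then sqNorm p u r else 0 := by
  split_ifs with h
  · rw [h, sqNorm]
  · exact hu.orthogonal r s h

theorem IsOrthogonalBasis.sqNorm_zero (hu : IsOrthogonalBasis p u e) (hp : ∑ i, p i = 1) :
    sqNorm p u 0 = 1 := by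
  simp [sqNorm, hu.zero_eq_one, hp]

end Basis

theorem hasSum_poissonProb {k : ℕ} (μ z : Fin (k + 1) → ℝ) :
    HasSum (fun y => poissonProb μ y * ∏ i, z i ^ y i) (Real.exp (∑ i, μ i * (z i - 1))) := by
  have h (i : Fin (k + 1)) : HasSum (fun m : ℕ => Real.exp (-μ i) * μ i ^ m / m.factorial * z i ^ m)
      (Real.exp (μ i * (z i - 1))) := by
    have h1 := (NormedSpace.expSeries_div_hasSum_exp (μ i * z i)).mul_left (Real.exp (-μ i))
    rw [← Real.exp_eq_exp_ℝ, ← Real.exp_add] at h1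
    rw [show μ i * (z i - 1) = -μ i + μ i * z i by ring]
    refine (hasSum_congr_fun fun m => ?_).2 h1
    rw [mul_pow]
    ring
  rw [Real.exp_sum]
  refine (hasSum_congr_fun fun y => ?_).2 (hasSum_prod_pi h)
  rw [poissonProb, ← Finset.prod_mul_distrib]

theorem poissonProb_pos {k : ℕ} {μ : Fin (k + 1) → ℝ} (hμ : ∀ i, 0 < μ i)
    (x : Fin (k + 1) → ℕ) : 0 < poissonProb μ x :=
  Finset.prod_pos fun i _ => by have := hμ i; positivity

/-- At most exponential growth. -/
def ExpGrowth {k : ℕ} (g : (Fin (k + 1) → ℕ) → ℝ) : Prop :=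
  ∃ (A : ℝ) (R : Fin (k + 1) → ℝ), ∀ y, |g y| ≤ A * ∏ i, R i ^ y i

theorem ExpGrowth.mul {k : ℕ} {f g : (Fin (k + 1) → ℕ) → ℝ} (hf : ExpGrowth f)
    (hg : ExpGrowth g) : ExpGrowth fun y => f y * g y := by
  obtain ⟨A, R, h⟩ := hf
  obtain ⟨B, T, h'⟩ := hg
  refine ⟨A * B, R * T, fun y => ?_⟩
  rw [abs_mul]
  refine (mul_le_mul (h y) (h' y) (abs_nonneg _) ((abs_nonneg _).trans (h y))).trans (le_of_eq ?_)
  simp only [Pi.mul_apply, mul_pow, Finset.prod_mul_distrib]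
  ring

theorem expGrowth_prod_pow {k : ℕ} (σ : Fin (k + 1) → ℝ) :
    ExpGrowth fun y => ∏ i, σ i ^ y i :=
  ⟨1, fun i => |σ i|, fun y => by simp [Finset.abs_prod, abs_pow]⟩

/-- The Poisson distribution has all exponential moments. -/
theorem ExpGrowth.summable {k : ℕ} {μ : Fin (k + 1) → ℝ} (hμ : ∀ i, 0 < μ i)
    {g : (Fin (k + 1) → ℕ) → ℝ} (hg : ExpGrowth g) : Summable fun y => poissonProb μ y * g y := by
  obtain ⟨A, R, h⟩ := hg
  refine Summable.of_norm_bounded ((hasSum_poissonProb μ R).summable.mul_left A) fun y => ?_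
  rw [Real.norm_eq_abs, abs_mul, abs_of_pos (poissonProb_pos hμ y), mul_left_comm]
  exact mul_le_mul_of_nonneg_left (h y) (poissonProb_pos hμ y).le

theorem charlierMajorant_nonneg {k : ℕ} {μ : Fin (k + 1) → ℝ} (hμ : ∀ i, 0 < μ i)
    (u : Fin (k + 1) → Fin (k + 1) → ℝ) (n x : Fin (k + 1) → ℕ) :
    0 ≤ charlierMajorant μ u n x :=
  (abs_nonneg _).trans (abs_mvCharlier_le (total_pos hμ) u n x)

/-- A single non-negative coefficient is at most the sum of the majorant series at w = 1, which is
exponential in y. -/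
theorem expGrowth_mvCharlier {k : ℕ} {μ : Fin (k + 1) → ℝ} (hμ : ∀ i, 0 < μ i)
    (u : Fin (k + 1) → Fin (k + 1) → ℝ) (n : Fin (k + 1) → ℕ) :
    ExpGrowth (mvCharlier μ u n) := by
  refine ⟨Real.exp 1, fun i => 1 + (1 + ∑ l : Fin k, |u l.succ i|) / total μ, fun y => ?_⟩
  refine (abs_mvCharlier_le (total_pos hμ) u n y).trans ?_
  have h := hasSum_charlierMajorant μ u y 1
  simpa using le_hasSum h n fun m _ => by simpa using charlierMajorant_nonneg hμ u m y

/-! ### Expectations by generating functions: transform and orthogonality. -/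

section Interchange

variable {k : ℕ} {μ : Fin (k + 1) → ℝ} {u : Fin (k + 1) → Fin (k + 1) → ℝ} {e : Fin (k + 1)}

/-- Absolute summability over pairs, by Tonelli applied to the majorant; it licenses exchanging the
expectation with the generating series. -/
theorem summable_mul_mvCharlier (hμ : ∀ i, 0 < μ i) {g : (Fin (k + 1) → ℕ) → ℝ}
    (hg : ExpGrowth g) (w : Fin (k + 1) → ℝ) :
    Summable fun q : (Fin (k + 1) → ℕ) × (Fin (k + 1) → ℕ) =>
      poissonProb μ q.1 * g q.1 * (mvCharlier μ u q.2 q.1 * ∏ l, w l ^ q.2 l) := by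
  have hb : Summable fun q : (Fin (k + 1) → ℕ) × (Fin (k + 1) → ℕ) =>
      poissonProb μ q.1 * |g q.1| * (charlierMajorant μ u q.2 q.1 * ∏ l, |w l| ^ q.2 l) := by
    refine (summable_prod_of_nonneg fun q => ?_).2 ⟨fun y => ?_, ?_⟩
    · have h1 := (poissonProb_pos hμ q.1).le
      have h2 := charlierMajorant_nonneg hμ u q.2 q.1
      positivity
    · exact (hasSum_charlierMajorant μ u y fun l => |w l|).summable.mul_left
        (poissonProb μ y * |g y|)
    · simp only [tsum_mul_left, (hasSum_charlierMajorant μ u _ fun l => |w l|).tsum_eq]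
      have h3 : ExpGrowth fun y : Fin (k + 1) → ℕ => |g y| := by
        obtain ⟨A, R, h⟩ := hg
        exact ⟨A, R, fun y => by rw [abs_abs]; exact h y⟩
      have h4 := (h3.mul (expGrowth_prod_pow fun i =>
        1 + (|w 0| + ∑ l : Fin k, |w l.succ| * |u l.succ i|) / total μ)).summable hμ
      refine (h4.mul_left (Real.exp |w 0|)).congr fun y => ?_
      ring
  refine Summable.of_norm_bounded hb fun q => ?_
  rw [Real.norm_eq_abs, abs_mul, abs_mul, abs_mul, abs_of_pos (poissonProb_pos hμ q.1),
    Finset.abs_prod]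
  simp only [abs_pow]
  have h1 := (poissonProb_pos hμ q.1).le
  gcongr
  exact abs_mvCharlier_le (total_pos hμ) u q.2 q.1

/-- The expectations of `g(Y) C_n(Y)` are generated by the expectation of `g(Y)` times the
generating function. -/
theorem hasSum_expectation_mvCharlier (hμ : ∀ i, 0 < μ i) (hu : ∀ i, u 0 i = 1)
    {g : (Fin (k + 1) → ℕ) → ℝ} (hg : ExpGrowth g) (w : Fin (k + 1) → ℝ) :
    HasSum (fun n => (∑' y, poissonProb μ y * g y * mvCharlier μ u n y) * ∏ l, w l ^ n l)
      (∑' y, poissonProb μ y * g y *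
        (Real.exp (w 0) * ∏ i, (1 + (∑ l, sgn l * w l * u l i) / total μ) ^ y i)) := by
  have hs := summable_mul_mvCharlier (u := u) hμ hg w
  have h1 := hs.hasSum.prod_fiberwise fun y =>
    ((hasSum_mvCharlier μ hu y w).mul_left (poissonProb μ y * g y))
  rw [h1.tsum_eq]
  have h2 := ((Equiv.prodComm _ _).hasSum_iff.2 hs.hasSum).prod_fiberwise fun n => (hs.prod_symm.prod_factor n).hasSum
  refine (hasSum_congr_fun fun n => ?_).2 h2
  rw [← tsum_mul_right]
  exact tsum_congr fun y => by simp only [Prod.swap]; ring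

/-- The linear forms of the displacement `σ - 1` in the direction of `u^{(l)}`. -/
def dualForm (μ : Fin (k + 1) → ℝ) (u : Fin (k + 1) → Fin (k + 1) → ℝ) (σ : Fin (k + 1) → ℝ)
    (l : Fin (k + 1)) : ℝ := ∑ j, prob μ j * u l j * (σ j - 1)

/-- Orthogonality of the basis isolates the variable w_l from the displacement of the generating
function. -/
theorem sum_shift (hu : IsOrthogonalBasis (prob μ) u e)
    (w : Fin (k + 1) → ℝ) (l : Fin (k + 1)) :
    ∑ j, prob μ j * u l j * ((∑ r, sgn r * w r * u r j) / total μ)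
      = sgn l * w l * sqNorm (prob μ) u l / total μ := by
  have h1 : ∑ j, prob μ j * u l j * ((∑ r, sgn r * w r * u r j) / total μ)
      = ∑ r, sgn r * w r / total μ * ∑ j, u l j * u r j * prob μ j := by
    simp only [Finset.mul_sum, Finset.sum_div]
    rw [Finset.sum_comm]
    exact Finset.sum_congr rfl fun r _ => Finset.sum_congr rfl fun j _ => by ring
  rw [h1]
  simp only [hu.sum_mul, mul_ite, mul_zero]
  rw [Finset.sum_ite_eq]
  simp only [Finset.mem_univ, if_true]
  ring

/-- The total of `μ_j` times the displacement of the generating function. -/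
theorem sum_mul_shift (hμ : ∀ i, 0 < μ i) (hu : IsOrthogonalBasis (prob μ) u e)
    (w : Fin (k + 1) → ℝ) :
    ∑ j, μ j * ((∑ r, sgn r * w r * u r j) / total μ) = - w 0 := by
  have h := congrArg (total μ * ·) (sum_shift hu w 0)
  simp only [Finset.mul_sum, hu.zero_eq_one, hu.sqNorm_zero (sum_prob hμ)] at h
  rw [mul_div_cancel₀ _ (total_pos hμ).ne'] at h
  rw [show -w 0 = sgn 0 * w 0 * 1 by simp [sgn], ← h]
  refine Finset.sum_congr rfl fun j _ => ?_
  rw [mul_one, ← mul_assoc, total_mul_prob hμ]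

theorem hasSum_pow_div_factorial {d : ℕ} (z w : Fin d → ℝ) :
    HasSum (fun n : Fin d → ℕ => (∏ l, z l ^ n l / (n l).factorial) * ∏ l, w l ^ n l)
      (Real.exp (∑ l, z l * w l)) := by
  have h (l : Fin d) : HasSum (fun m : ℕ => z l ^ m / m.factorial * w l ^ m)
      (Real.exp (z l * w l)) := by
    have h1 := NormedSpace.expSeries_div_hasSum_exp (z l * w l)
    rw [← Real.exp_eq_exp_ℝ] at h1
    refine (hasSum_congr_fun fun m => ?_).2 h1
    rw [mul_pow]
    ring
  rw [Real.exp_sum]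
  refine (hasSum_congr_fun fun n => ?_).2 (hasSum_prod_pi h)
  rw [← Finset.prod_mul_distrib]

/-- The transform `E[∏ σ_i^{Y_i} C_n(Y)]`. -/
theorem hasSum_transform_mvCharlier (hμ : ∀ i, 0 < μ i) (hu : IsOrthogonalBasis (prob μ) u e)
    (σ : Fin (k + 1) → ℝ) (n : Fin (k + 1) → ℕ) :
    HasSum (fun y => poissonProb μ y * (∏ i, σ i ^ y i) * mvCharlier μ u n y)
      (Real.exp (∑ i, μ i * (σ i - 1)) *
        ∏ l, (sgn l * dualForm μ u σ l) ^ n l / (n l).factorial) := by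
  have hg := expGrowth_prod_pow (k := k) σ
  have hs : Summable fun y => poissonProb μ y * (∏ i, σ i ^ y i) * mvCharlier μ u n y := by
    refine ((hg.mul (expGrowth_mvCharlier hμ u n)).summable hμ).congr fun y => ?_
    ring
  have key : (fun n => ∑' y, poissonProb μ y * (∏ i, σ i ^ y i) * mvCharlier μ u n y)
      = fun n => Real.exp (∑ i, μ i * (σ i - 1)) *
        ∏ l, (sgn l * dualForm μ u σ l) ^ n l / (n l).factorial := by
    refine coeff_unique (fun w => hasSum_expectation_mvCharlier hμ hu.zero_eq_one hg w) fun w => ?_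
    have h1 := (hasSum_pow_div_factorial (fun l => sgn l * dualForm μ u σ l) w).mul_left
      (Real.exp (∑ i, μ i * (σ i - 1)))
    have h2 := (hasSum_poissonProb μ fun i =>
      σ i * (1 + (∑ l, sgn l * w l * u l i) / total μ)).mul_left (Real.exp (w 0))
    have h3 : ∑' y, poissonProb μ y * (∏ i, σ i ^ y i) *
        (Real.exp (w 0) * ∏ i, (1 + (∑ l, sgn l * w l * u l i) / total μ) ^ y i)
        = Real.exp (∑ i, μ i * (σ i - 1)) *
          Real.exp (∑ l, sgn l * dualForm μ u σ l * w l) := by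
      have h4 : ∑ l, sgn l * dualForm μ u σ l * w l
          = ∑ i, μ i * ((∑ l, sgn l * w l * u l i) / total μ) * (σ i - 1) := by
        simp only [dualForm, Finset.mul_sum, Finset.sum_mul, Finset.sum_div]
        rw [Finset.sum_comm]
        refine Finset.sum_congr rfl fun i _ => Finset.sum_congr rfl fun l _ => ?_
        rw [prob]
        ring
      have h5 := sum_mul_shift hμ hu w
      rw [← Real.exp_add, h4]
      rw [← Real.exp_add] at h2
      -- The displacement has μ-total -w_0, which cancels the prefactor e^{w_0} and leaves an
      -- exponent linear in w.
      have h6 : w 0 + ∑ i, μ i * (σ i * (1 + (∑ l, sgn l * w l * u l i) / total μ) - 1)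
          = ∑ i, μ i * (σ i - 1) +
            ∑ i, μ i * ((∑ l, sgn l * w l * u l i) / total μ) * (σ i - 1) := by
        rw [← neg_eq_iff_eq_neg.2 h5, ← Finset.sum_neg_distrib, ← Finset.sum_add_distrib,
          ← Finset.sum_add_distrib]
        exact Finset.sum_congr rfl fun i _ => by ring
      rw [← h6, ← h2.tsum_eq]
      refine tsum_congr fun y => ?_
      simp only [mul_pow, Finset.prod_mul_distrib]
      ring
    rw [h3]
    refine (hasSum_congr_fun fun n => ?_).2 h1
    ring
  rw [← congrFun key n]
  exact hs.hasSum

theorem hCoeff_pos (hμ : ∀ i, 0 < μ i) (hu : IsOrthogonalBasis (prob μ) u e)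
    (n : Fin (k + 1) → ℕ) : 0 < hCoeff μ u n := by
  have h1 := total_pos hμ
  refine mul_pos (pow_pos h1 _) (Finset.prod_pos fun j _ => ?_)
  have h2 := hu.sqNorm_pos (prob_pos hμ) j
  positivity

theorem inv_hCoeff (hμ : ∀ i, 0 < μ i) (n : Fin (k + 1) → ℕ) :
    (hCoeff μ u n)⁻¹ = ∏ l, (sqNorm (prob μ) u l / total μ) ^ n l / (n l).factorial := by
  have h1 := (total_pos hμ).ne'
  rw [hCoeff, size, ← Finset.prod_pow_eq_pow_sum, ← Finset.prod_mul_distrib,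
    ← Finset.prod_inv_distrib]
  refine Finset.prod_congr rfl fun l _ => ?_
  rw [div_pow, mul_inv, inv_div]
  ring

/-- The polynomials `C_n` are orthogonal with respect to the Poisson distribution, and `h_n` is
the reciprocal of the mean square of `C_n`. -/
theorem hasSum_mvCharlier_mul_mvCharlier (hμ : ∀ i, 0 < μ i)
    (hu : IsOrthogonalBasis (prob μ) u e) (m n : Fin (k + 1) → ℕ) :
    HasSum (fun y => poissonProb μ y * mvCharlier μ u m y * mvCharlier μ u n y)
      (if m = n then (hCoeff μ u n)⁻¹ else 0) := by
  have hg := expGrowth_mvCharlier hμ u n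
  have hs : Summable fun y => poissonProb μ y * mvCharlier μ u m y * mvCharlier μ u n y := by
    refine (((expGrowth_mvCharlier hμ u m).mul hg).summable hμ).congr fun y => ?_
    ring
  have key : (fun m => ∑' y, poissonProb μ y * mvCharlier μ u n y * mvCharlier μ u m y)
      = fun m => if m = n then (hCoeff μ u n)⁻¹ else 0 := by
    refine coeff_unique (fun w => hasSum_expectation_mvCharlier hμ hu.zero_eq_one hg w) fun w => ?_
    -- The generating function is e^{w_0} ∏ σ_i^{y_i} with σ the displaced point, so its pairing
    -- with C_n is a value of the transform. It reduces to a single monomial in w, whence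
    -- orthogonality.
    have h1 := (hasSum_transform_mvCharlier hμ hu
      (fun i => 1 + (∑ l, sgn l * w l * u l i) / total μ) n).mul_left (Real.exp (w 0))
    have h2 : ∑' y, poissonProb μ y * mvCharlier μ u n y *
        (Real.exp (w 0) * ∏ i, (1 + (∑ l, sgn l * w l * u l i) / total μ) ^ y i)
        = (hCoeff μ u n)⁻¹ * ∏ l, w l ^ n l := by
      have h3 : Real.exp (w 0) * (Real.exp (∑ i, μ i *
            ((1 + (∑ l, sgn l * w l * u l i) / total μ) - 1)) *
          ∏ l, (sgn l * dualForm μ u (fun i => 1 + (∑ l, sgn l * w l * u l i) / total μ) l) ^ n l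
            / (n l).factorial) = (hCoeff μ u n)⁻¹ * ∏ l, w l ^ n l := by
        simp only [dualForm, add_sub_cancel_left, sum_shift hu, sum_mul_shift hμ hu]
        rw [← mul_assoc, ← Real.exp_add, add_neg_cancel, Real.exp_zero, one_mul, inv_hCoeff hμ,
          ← Finset.prod_mul_distrib]
        refine Finset.prod_congr rfl fun l _ => ?_
        rw [div_mul_eq_mul_div, ← mul_pow]
        congr 2
        rw [mul_div_assoc, mul_assoc, ← mul_assoc, sgn_mul_self]
        ring
      rw [← h3, ← h1.tsum_eq]
      exact tsum_congr fun y => by ring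
    rw [h2]
    convert hasSum_ite_eq n ((hCoeff μ u n)⁻¹ * ∏ l, w l ^ n l) using 2 with m
    split_ifs with h
    · rw [h]
    · simp
  rw [← congrFun key m, tsum_congr fun y => mul_right_comm (poissonProb μ y) _ _]
  exact hs.hasSum

end Interchange

/-! ### The ℓ² picture: Bessel's inequality and termwise integration. -/

section SquareSummable

variable {k : ℕ} {μ : Fin (k + 1) → ℝ} {u : Fin (k + 1) → Fin (k + 1) → ℝ} {e : Fin (k + 1)}

/-- The function `√P φ` as a square-summable family. -/
def weighted (μ : Fin (k + 1) → ℝ) (hμ : ∀ i, 0 < μ i) (φ : (Fin (k + 1) → ℕ) → ℝ)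
    (hφ : Summable fun y => poissonProb μ y * φ y ^ 2) :
    lp (fun _ : Fin (k + 1) → ℕ => ℝ) 2 :=
  ⟨fun y => √(poissonProb μ y) * φ y, memℓp_gen (by
    refine hφ.congr fun y => ?_
    simp [mul_pow, Real.sq_sqrt (poissonProb_pos hμ y).le])⟩

theorem inner_weighted (hμ : ∀ i, 0 < μ i) {φ ψ : (Fin (k + 1) → ℕ) → ℝ}
    (hφ : Summable fun y => poissonProb μ y * φ y ^ 2)
    (hψ : Summable fun y => poissonProb μ y * ψ y ^ 2) :
    HasSum (fun y => poissonProb μ y * φ y * ψ y)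
      (inner ℝ (weighted μ hμ φ hφ) (weighted μ hμ ψ hψ)) := by
  refine (hasSum_congr_fun fun y => ?_).2 (lp.hasSum_inner _ _)
  have h := Real.mul_self_sqrt (poissonProb_pos hμ y).le
  simp only [weighted, RCLike.inner_apply, conj_trivial]
  linear_combination (-φ y * ψ y) * h

theorem summable_mvCharlier_sq (hμ : ∀ i, 0 < μ i) (u : Fin (k + 1) → Fin (k + 1) → ℝ)
    (n : Fin (k + 1) → ℕ) : Summable fun y => poissonProb μ y * mvCharlier μ u n y ^ 2 := by
  have h := expGrowth_mvCharlier hμ u n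
  simpa [sq] using (h.mul h).summable hμ

theorem summable_smul_sq {φ : (Fin (k + 1) → ℕ) → ℝ}
    (hφ : Summable fun y => poissonProb μ y * φ y ^ 2) (c : ℝ) :
    Summable fun y => poissonProb μ y * (c * φ y) ^ 2 := by
  refine (hφ.mul_left (c ^ 2)).congr fun y => ?_
  ring

/-- The normalized polynomials `√h_n C_n`, weighted by `√P`. -/
def charlierVec (hμ : ∀ i, 0 < μ i) (u : Fin (k + 1) → Fin (k + 1) → ℝ) (n : Fin (k + 1) → ℕ) :
    lp (fun _ : Fin (k + 1) → ℕ => ℝ) 2 :=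
  weighted μ hμ (fun y => √(hCoeff μ u n) * mvCharlier μ u n y)
    (summable_smul_sq (summable_mvCharlier_sq hμ u n) _)

theorem orthonormal_charlierVec (hμ : ∀ i, 0 < μ i) (hu : IsOrthogonalBasis (prob μ) u e) :
    Orthonormal ℝ (charlierVec hμ u) := by
  rw [orthonormal_iff_ite]
  intro m n
  have h1 := inner_weighted hμ (summable_smul_sq (summable_mvCharlier_sq hμ u m) √(hCoeff μ u m))
    (summable_smul_sq (summable_mvCharlier_sq hμ u n) √(hCoeff μ u n))
  have h2 := (hasSum_mvCharlier_mul_mvCharlier hμ hu m n).mul_left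
    (√(hCoeff μ u m) * √(hCoeff μ u n))
  rw [charlierVec, charlierVec]
  refine (h1.unique ((hasSum_congr_fun fun y => ?_).2 h2)).trans ?_
  · ring
  · split_ifs with h
    · have h3 := hCoeff_pos hμ hu n
      rw [h, Real.mul_self_sqrt h3.le, mul_inv_cancel₀ h3.ne']
    · simp

/-- Bessel's inequality for the unit vector at x, whose coefficient against the n-th orthonormal
vector is √(P(x) h_n) C_n(x). -/
theorem summable_hCoeff_mul_sq (hμ : ∀ i, 0 < μ i) (hu : IsOrthogonalBasis (prob μ) u e)
    (x : Fin (k + 1) → ℕ) : Summable fun n => hCoeff μ u n * mvCharlier μ u n x ^ 2 := by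
  classical
  have h1 := (orthonormal_charlierVec hμ hu).inner_products_summable
    (lp.single (E := fun _ : Fin (k + 1) → ℕ => ℝ) 2 x (1 : ℝ))
  refine (h1.mul_left (poissonProb μ x)⁻¹).congr fun n => ?_
  have h2 := poissonProb_pos hμ x
  rw [lp.inner_single_right]
  simp only [charlierVec, weighted, RCLike.inner_apply, conj_trivial, one_mul, Real.norm_eq_abs,
    sq_abs, mul_pow, Real.sq_sqrt h2.le, Real.sq_sqrt (hCoeff_pos hμ hu n).le]
  field_simp

theorem convergesInMeanSquare_of_bounded (hμ : ∀ i, 0 < μ i)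
    (hu : IsOrthogonalBasis (prob μ) u e) {ρ : (Fin (k + 1) → ℕ) → ℝ} {K : ℝ}
    (hK : ∀ n, |ρ n| ≤ K) : ConvergesInMeanSquare μ u ρ := by
  intro x
  refine Summable.of_nonneg_of_le (fun n => ?_) (fun n => ?_)
    ((summable_hCoeff_mul_sq hμ hu x).mul_left (K ^ 2))
  · have := (hCoeff_pos hμ hu n).le
    positivity
  · have := (hCoeff_pos hμ hu n).le
    rw [mul_assoc]
    refine mul_le_mul_of_nonneg_right ?_ (by positivity)
    rw [← sq_abs]
    exact pow_le_pow_left₀ (abs_nonneg _) (hK n) 2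

/-- The full series `∑_n ρ_n h_n C_n(x) C_n(y)`. -/
def kernelSum (μ : Fin (k + 1) → ℝ) (u : Fin (k + 1) → Fin (k + 1) → ℝ)
    (ρ : (Fin (k + 1) → ℕ) → ℝ) (x y : Fin (k + 1) → ℕ) : ℝ := ∑' n, expansionTerm μ u ρ x y n

/-- Each term is at most the sum of ρ_n² h_n C_n(x)² and h_n C_n(y)²; the first is summable by
hypothesis, the second by Bessel. -/
theorem ConvergesInMeanSquare.summable_expansionTerm (hμ : ∀ i, 0 < μ i)
    (hu : IsOrthogonalBasis (prob μ) u e) {ρ : (Fin (k + 1) → ℕ) → ℝ}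
    (hρ : ConvergesInMeanSquare μ u ρ) (x y : Fin (k + 1) → ℕ) :
    Summable (expansionTerm μ u ρ x y) := by
  refine Summable.of_norm_bounded ((hρ x).add (summable_hCoeff_mul_sq hμ hu y)) fun n => ?_
  have h := (hCoeff_pos hμ hu n).le
  rw [expansionTerm, Real.norm_eq_abs,
    show ρ n * hCoeff μ u n * mvCharlier μ u n x * mvCharlier μ u n y
      = hCoeff μ u n * ((ρ n * mvCharlier μ u n x) * mvCharlier μ u n y) by ring, abs_mul,
    abs_of_nonneg h, show ρ n ^ 2 * hCoeff μ u n * mvCharlier μ u n x ^ 2 +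
      hCoeff μ u n * mvCharlier μ u n y ^ 2 = hCoeff μ u n *
        ((ρ n * mvCharlier μ u n x) ^ 2 + mvCharlier μ u n y ^ 2) by ring]
  refine mul_le_mul_of_nonneg_left ?_ h
  rw [abs_le]
  constructor <;>
  nlinarith [sq_nonneg (ρ n * mvCharlier μ u n x - mvCharlier μ u n y),
    sq_nonneg (ρ n * mvCharlier μ u n x + mvCharlier μ u n y),
    sq_nonneg (ρ n * mvCharlier μ u n x), sq_nonneg (mvCharlier μ u n y)]

/-- Under mean square convergence, the sum of the series may be integrated termwise against
any square-integrable function. -/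
theorem ConvergesInMeanSquare.exists_hasSum (hμ : ∀ i, 0 < μ i)
    (hu : IsOrthogonalBasis (prob μ) u e) {ρ : (Fin (k + 1) → ℕ) → ℝ}
    (hρ : ConvergesInMeanSquare μ u ρ) (x : Fin (k + 1) → ℕ) {φ : (Fin (k + 1) → ℕ) → ℝ}
    (hφ : Summable fun y => poissonProb μ y * φ y ^ 2) :
    ∃ s : ℝ, HasSum (fun y => poissonProb μ y * φ y * kernelSum μ u ρ x y) s ∧
      HasSum (fun n => ρ n * hCoeff μ u n * mvCharlier μ u n x *
        ∑' y, poissonProb μ y * φ y * mvCharlier μ u n y) s := by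
  classical
  have hv := orthonormal_charlierVec hμ hu
  set a : (Fin (k + 1) → ℕ) → ℝ := fun n => ρ n * √(hCoeff μ u n) * mvCharlier μ u n x with ha
  have hs : Summable fun n => a n • charlierVec hμ u n := by
    have h1 := (hv.orthogonalFamily.summable_iff_norm_sq_summable a).2 (by
      refine (hρ x).congr fun n => ?_
      rw [ha, Real.norm_eq_abs, sq_abs, mul_pow, mul_pow, Real.sq_sqrt (hCoeff_pos hμ hu n).le])
    simpa using h1
  obtain ⟨S, hS⟩ := hs
  have hinner (ψ : lp (fun _ : Fin (k + 1) → ℕ => ℝ) 2) :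
      HasSum (fun n => a n * inner ℝ ψ (charlierVec hμ u n)) (inner ℝ ψ S) := by
    simpa [inner_smul_right] using hS.mapL (innerSL ℝ ψ)
  -- Evaluation at y is an inner product with a unit vector, hence continuous, so the ℓ² limit is
  -- the pointwise sum up to the weight √P.
  have hval (y : Fin (k + 1) → ℕ) : S y = √(poissonProb μ y) * kernelSum μ u ρ x y := by
    have h1 := hinner (lp.single (E := fun _ : Fin (k + 1) → ℕ => ℝ) 2 y (1 : ℝ))
    simp only [lp.inner_single_left] at h1
    have h2 : HasSum (fun n => a n * inner ℝ (1 : ℝ) (charlierVec hμ u n y))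
        (√(poissonProb μ y) * kernelSum μ u ρ x y) := by
      refine (hasSum_congr_fun fun n => ?_).2
        ((hρ.summable_expansionTerm hμ hu x y).hasSum.mul_left (√(poissonProb μ y)))
      have h3 := Real.mul_self_sqrt (hCoeff_pos hμ hu n).le
      simp only [ha, charlierVec, weighted, RCLike.inner_apply, conj_trivial, mul_one,
        expansionTerm]
      linear_combination (ρ n * mvCharlier μ u n x * √(poissonProb μ y) * mvCharlier μ u n y) * h3
    have h4 := h1.unique h2
    simpa using h4
  refine ⟨inner ℝ (weighted μ hμ φ hφ) S, ?_, ?_⟩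
  · refine (hasSum_congr_fun fun y => ?_).2 (lp.hasSum_inner _ _)
    have h := Real.mul_self_sqrt (poissonProb_pos hμ y).le
    simp only [weighted, RCLike.inner_apply, conj_trivial, hval]
    linear_combination (-φ y * kernelSum μ u ρ x y) * h
  · refine (hasSum_congr_fun fun n => ?_).2 (hinner _)
    have h1 := inner_weighted hμ hφ
      (summable_smul_sq (summable_mvCharlier_sq hμ u n) √(hCoeff μ u n))
    have h2 : ∑' y, poissonProb μ y * φ y * (√(hCoeff μ u n) * mvCharlier μ u n y)
        = √(hCoeff μ u n) * ∑' y, poissonProb μ y * φ y * mvCharlier μ u n y := by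
      rw [← tsum_mul_left]
      exact tsum_congr fun y => by ring
    have h3 := Real.mul_self_sqrt (hCoeff_pos hμ hu n).le
    rw [charlierVec, ← h1.tsum_eq, h2, ha]
    linear_combination (-ρ n * mvCharlier μ u n x *
      ∑' y, poissonProb μ y * φ y * mvCharlier μ u n y) * h3

theorem ConvergesInMeanSquare.hasSum_mvCharlier_mul (hμ : ∀ i, 0 < μ i)
    (hu : IsOrthogonalBasis (prob μ) u e) {ρ : (Fin (k + 1) → ℕ) → ℝ}
    (hρ : ConvergesInMeanSquare μ u ρ) (m x : Fin (k + 1) → ℕ) :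
    HasSum (fun y => poissonProb μ y * mvCharlier μ u m y * kernelSum μ u ρ x y)
      (ρ m * mvCharlier μ u m x) := by
  obtain ⟨s, h1, h2⟩ := hρ.exists_hasSum hμ hu x (summable_mvCharlier_sq hμ u m)
  simp only [(hasSum_mvCharlier_mul_mvCharlier hμ hu m _).tsum_eq] at h2
  have h3 := hasSum_single (f := fun n => ρ n * hCoeff μ u n * mvCharlier μ u n x *
    if m = n then (hCoeff μ u n)⁻¹ else 0) m (fun n hn => by simp [hn.symm])
  rw [h2.unique h3] at h1
  have h4 := (hCoeff_pos hμ hu m).ne'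
  convert h1 using 1
  simp only [if_true]
  field_simp

end SquareSummable

/-! ### Marginals, correlations, and the bound on the eigenvalues. -/

section Bivariate

variable {k : ℕ} {μ : Fin (k + 1) → ℝ} {u : Fin (k + 1) → Fin (k + 1) → ℝ} {e : Fin (k + 1)}
  {ρ : (Fin (k + 1) → ℕ) → ℝ}

theorem mvCharlier_zero (μ : Fin (k + 1) → ℝ) (hu : ∀ i, u 0 i = 1) (x : Fin (k + 1) → ℕ) :
    mvCharlier μ u 0 x = 1 := by
  have h1 := hasSum_mvCharlier μ hu x 0
  have h2 := hasSum_single (f := fun n : Fin (k + 1) → ℕ =>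
    mvCharlier μ u n x * ∏ l, (0 : Fin (k + 1) → ℝ) l ^ n l) 0 fun n hn => by
      obtain ⟨l, hl⟩ := Function.ne_iff.1 hn
      rw [Finset.prod_eq_zero (Finset.mem_univ l) (by simpa using hl), mul_zero]
  simpa using h2.unique h1

theorem hCoeff_zero : hCoeff μ u 0 = 1 := by simp [hCoeff, size]

theorem one_le_size_iff (n : Fin (k + 1) → ℕ) : 1 ≤ size n ↔ n ≠ 0 := by
  rw [Nat.one_le_iff_ne_zero, size, Ne, Finset.sum_eq_zero_iff, Ne, funext_iff]
  simp

/-- The separate `1` in the expansion is the term n = 0, because ρ_0 = h_0 = C_0 = 1. -/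
theorem expansion_eq (hu : ∀ i, u 0 i = 1) (hρ : ρ 0 = 1) {x y : Fin (k + 1) → ℕ}
    (hs : Summable (expansionTerm μ u ρ x y)) :
    expansion μ u ρ x y = poissonProb μ x * poissonProb μ y * kernelSum μ u ρ x y := by
  classical
  rw [expansion, kernelSum, hs.tsum_eq_add_tsum_ite 0]
  congr 2
  · rw [expansionTerm, hρ, hCoeff_zero, mvCharlier_zero μ hu, mvCharlier_zero μ hu]
    norm_num
  · refine (tsum_subtype {n : Fin (k + 1) → ℕ | 1 ≤ size n} (expansionTerm μ u ρ x y)).trans ?_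
    refine tsum_congr fun n => ?_
    by_cases hn : n = 0
    · rw [Set.indicator_of_notMem, if_pos hn]
      rw [Set.mem_ofPred_eq, one_le_size_iff]
      exact fun h => h hn
    · rw [Set.indicator_of_mem, if_neg hn]
      exact (one_le_size_iff n).2 hn

theorem expansion_comm (μ : Fin (k + 1) → ℝ) (u : Fin (k + 1) → Fin (k + 1) → ℝ)
    (ρ : (Fin (k + 1) → ℕ) → ℝ) (x y : Fin (k + 1) → ℕ) :
    expansion μ u ρ x y = expansion μ u ρ y x := by
  rw [expansion, expansion, mul_comm (poissonProb μ x)]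
  congr 2
  exact tsum_congr fun n => by rw [expansionTerm, expansionTerm]; ring

/-- The polynomials `C_m` are eigenfunctions of the kernel. -/
theorem ConvergesInMeanSquare.hasSum_mvCharlier_mul_expansion (hμ : ∀ i, 0 < μ i)
    (hu : IsOrthogonalBasis (prob μ) u e) (hρ0 : ρ 0 = 1) (hρ : ConvergesInMeanSquare μ u ρ)
    (m x : Fin (k + 1) → ℕ) :
    HasSum (fun y => mvCharlier μ u m y * expansion μ u ρ x y)
      (poissonProb μ x * (ρ m * mvCharlier μ u m x)) := by
  refine (hasSum_congr_fun fun y => ?_).2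
    ((hρ.hasSum_mvCharlier_mul hμ hu m x).mul_left (poissonProb μ x))
  rw [expansion_eq hu.zero_eq_one hρ0 (hρ.summable_expansionTerm hμ hu x y)]
  ring

theorem ConvergesInMeanSquare.hasSum_expansion (hμ : ∀ i, 0 < μ i)
    (hu : IsOrthogonalBasis (prob μ) u e) (hρ0 : ρ 0 = 1) (hρ : ConvergesInMeanSquare μ u ρ)
    (x : Fin (k + 1) → ℕ) :
    HasSum (fun y => expansion μ u ρ x y) (poissonProb μ x) := by
  simpa [mvCharlier_zero μ hu.zero_eq_one, hρ0] using
    hρ.hasSum_mvCharlier_mul_expansion hμ hu hρ0 0 x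

theorem summable_left_of_marginal {P : (Fin (k + 1) → ℕ) → ℝ}
    {f : (Fin (k + 1) → ℕ) → (Fin (k + 1) → ℕ) → ℝ} (hf : ∀ x y, 0 ≤ f x y)
    (hm : ∀ x, HasSum (f x) (P x)) {g : (Fin (k + 1) → ℕ) → ℝ} (hg : ∀ x, 0 ≤ g x)
    (hs : Summable fun x => P x * g x) :
    Summable fun z : (Fin (k + 1) → ℕ) × (Fin (k + 1) → ℕ) => g z.1 * f z.1 z.2 := by
  refine (summable_prod_of_nonneg fun z => mul_nonneg (hg _) (hf _ _)).2
    ⟨fun x => (hm x).summable.mul_left (g x), ?_⟩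
  simp only [tsum_mul_left, (hm _).tsum_eq]
  exact hs.congr fun x => mul_comm _ _

/-- If the marginals of a non-negative array are `P`, then products of functions that are
square-integrable with respect to `P` are integrable. -/
theorem summable_mul_of_marginals {P : (Fin (k + 1) → ℕ) → ℝ}
    {f : (Fin (k + 1) → ℕ) → (Fin (k + 1) → ℕ) → ℝ} (hf : ∀ x y, 0 ≤ f x y)
    (hm : ∀ x, HasSum (f x) (P x)) (hm' : ∀ y, HasSum (fun x => f x y) (P y))
    {φ ψ : (Fin (k + 1) → ℕ) → ℝ} (hφ : Summable fun x => P x * φ x ^ 2)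
    (hψ : Summable fun x => P x * ψ x ^ 2) :
    Summable fun z : (Fin (k + 1) → ℕ) × (Fin (k + 1) → ℕ) => φ z.1 * ψ z.2 * f z.1 z.2 := by
  have h1 := summable_left_of_marginal hf hm (fun x => sq_nonneg (φ x)) hφ
  have h2 := (summable_left_of_marginal (fun y x => hf x y) hm' (fun x => sq_nonneg (ψ x))
    hψ).prod_symm
  refine Summable.of_norm_bounded (h1.add h2) fun z => ?_
  have h3 := hf z.1 z.2
  rw [Real.norm_eq_abs, abs_mul, abs_of_nonneg h3, Prod.fst_swap, Prod.snd_swap, ← add_mul]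
  refine mul_le_mul_of_nonneg_right ?_ h3
  rw [abs_le]
  constructor <;>
  nlinarith [sq_nonneg (φ z.1 - ψ z.2), sq_nonneg (φ z.1 + ψ z.2), sq_nonneg (φ z.1),
    sq_nonneg (ψ z.2)]

/-- The eigenfunction relation with m = 0 gives the marginals. With f ≥ 0 these make products of
square-integrable functions summable over pairs, so the correlations may be computed by summing over
y first. -/
theorem isBivariatePoisson_of_nonneg (hμ : ∀ i, 0 < μ i) (hu : IsOrthogonalBasis (prob μ) u e)
    (hρ0 : ρ 0 = 1) (hρ : ConvergesInMeanSquare μ u ρ) (h0 : ∀ x y, 0 ≤ expansion μ u ρ x y) :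
    IsBivariatePoisson μ u ρ := by
  have hm := hρ.hasSum_expansion hμ hu hρ0
  have hm' : ∀ y, HasSum (fun x => expansion μ u ρ x y) (poissonProb μ y) := fun y => by
    simpa only [expansion_comm μ u ρ _ y] using hm y
  refine ⟨fun x y => (hρ.summable_expansionTerm hμ hu x y).subtype _, h0, hm, hm', fun m n => ?_⟩
  have hs := summable_mul_of_marginals h0 hm hm' (summable_mvCharlier_sq hμ u m)
    (summable_mvCharlier_sq hμ u n)
  have h1 := hs.hasSum.prod_fiberwise fun x => by
    simpa only [mul_assoc] using
      (hρ.hasSum_mvCharlier_mul_expansion hμ hu hρ0 n x).mul_left (mvCharlier μ u m x)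
  have h2 := (hasSum_mvCharlier_mul_mvCharlier hμ hu m n).mul_left (ρ n)
  have h3 := h1.unique ((hasSum_congr_fun fun x => by ring).2 h2)
  have h4 := hs.hasSum
  rw [h3] at h4
  convert h4 using 1
  split_ifs <;> simp [div_eq_mul_inv]

/-- From E[(c C_n(X) - C_n(Y))²] ≥ 0 with c = ±1, both second moments being 1/h_n. No mean-square
convergence enters, so it can be deduced from this bound. -/
theorem IsBivariatePoisson.abs_le_one (hμ : ∀ i, 0 < μ i) (hu : IsOrthogonalBasis (prob μ) u e)
    (h : IsBivariatePoisson μ u ρ) (n : Fin (k + 1) → ℕ) : |ρ n| ≤ 1 := by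
  have hsq := summable_mvCharlier_sq hμ u n
  have h1 := summable_left_of_marginal h.nonneg h.marginal_left
    (fun x => sq_nonneg (mvCharlier μ u n x)) hsq
  have h2 := summable_left_of_marginal (fun y x => h.nonneg x y) h.marginal_right
    (fun x => sq_nonneg (mvCharlier μ u n x)) hsq
  have hn : HasSum (fun x => mvCharlier μ u n x ^ 2 * poissonProb μ x) (hCoeff μ u n)⁻¹ := by
    have h3 := hasSum_mvCharlier_mul_mvCharlier hμ hu n n
    rw [if_pos rfl] at h3
    exact (hasSum_congr_fun fun x => by ring).2 h3
  have e1 := h1.hasSum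
  rw [(h1.hasSum.prod_fiberwise fun x =>
    (h.marginal_left x).mul_left (mvCharlier μ u n x ^ 2)).unique hn] at e1
  have e2 := h2.hasSum
  rw [(h2.hasSum.prod_fiberwise fun x =>
    (h.marginal_right x).mul_left (mvCharlier μ u n x ^ 2)).unique hn] at e2
  have e2 := (Equiv.prodComm _ _).hasSum_iff.2 e2
  have e3 := h.correlation n n
  rw [if_pos rfl] at e3
  have hpos := hCoeff_pos hμ hu n
  have key (c : ℝ) (hc : c ^ 2 = 1) : c * (ρ n / hCoeff μ u n) ≤ (hCoeff μ u n)⁻¹ := by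
    have h5 := hasSum_le (fun z => ?_) (e3.mul_left c) ((e1.add e2).mul_left (1 / 2))
    · linarith
    · have h6 := h.nonneg z.1 z.2
      simp only [Function.comp_apply, Equiv.prodComm_apply, Prod.fst_swap, Prod.snd_swap]
      have h7 := mul_nonneg (sq_nonneg (c * mvCharlier μ u n z.1 - mvCharlier μ u n z.2)) h6
      have h8 : (c * mvCharlier μ u n z.1 - mvCharlier μ u n z.2) ^ 2 = mvCharlier μ u n z.1 ^ 2 -
          2 * (c * (mvCharlier μ u n z.1 * mvCharlier μ u n z.2)) + mvCharlier μ u n z.2 ^ 2 := by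
        linear_combination mvCharlier μ u n z.1 ^ 2 * hc
      rw [h8] at h7
      linarith
  have k1 := key 1 (by norm_num)
  have k2 := key (-1) (by norm_num)
  rw [one_mul, div_eq_mul_inv] at k1
  rw [div_eq_mul_inv] at k2
  have hinv := inv_pos.2 hpos
  rw [abs_le]
  constructor
  · by_contra hlt
    nlinarith [mul_pos (sub_pos.2 (not_le.1 hlt)) hinv]
  · by_contra hlt
    nlinarith [mul_pos (sub_pos.2 (not_le.1 hlt)) hinv]

end Bivariate

/-! ### Representable arrays give non-negative expansions. -/

section Representable

variable {k : ℕ} {μ : Fin (k + 1) → ℝ} {p : Fin (k + 1) → ℝ}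
  {u : Fin (k + 1) → Fin (k + 1) → ℝ} {e : Fin (k + 1)} {ρ : (Fin (k + 1) → ℕ) → ℝ}

/-- The product formula: j ↦ p_j 𝔰(i, j, l) acts as the convolution of the points i and l, and the
basis functions are its characters. -/
theorem sum_mul_tripleSum (hu : IsOrthogonalBasis p u e) (hp : ∀ i, 0 < p i)
    (r i l : Fin (k + 1)) :
    ∑ j, p j * u r j * tripleSum p u i j l = u r i * u r l := by
  have h1 : ∑ j, p j * u r j * tripleSum p u i j l
      = ∑ s, (sqNorm p u s)⁻¹ * u s i * u s l * ∑ j, u r j * u s j * p j := by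
    simp only [tripleSum, Finset.mul_sum]
    rw [Finset.sum_comm]
    exact Finset.sum_congr rfl fun s _ => Finset.sum_congr rfl fun j _ => by ring
  rw [h1]
  simp only [hu.sum_mul, mul_ite, mul_zero]
  rw [Finset.sum_ite_eq]
  have := (hu.sqNorm_pos hp r).ne'
  simp only [Finset.mem_univ, if_true]
  field_simp

/-- Under the hypergroup property the functions of the basis are bounded by `1`. -/
theorem HypergroupProperty.abs_le_one (hyper : HypergroupProperty p u)
    (hu : IsOrthogonalBasis p u e) (hp : ∀ i, 0 < p i) (r l : Fin (k + 1)) : |u r l| ≤ 1 := by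
  obtain ⟨i, -, hi⟩ := Finset.exists_max_image Finset.univ (fun i => |u r i|)
    Finset.univ_nonempty
  have hpos : 0 < |u r i| := by
    have h := hi e (Finset.mem_univ _)
    rw [hu.scaled, abs_one] at h
    linarith
  -- By the product formula with r = 0 these non-negative weights average. At a maximizer i of
  -- |u_i|, the product u_i u_l is an average of values of modulus at most |u_i|.
  have h1 : ∑ j, p j * tripleSum p u i j l = 1 := by
    have h := sum_mul_tripleSum hu hp 0 i l
    simpa [hu.zero_eq_one] using h
  have h2 : |u r i| * |u r l| ≤ |u r i| * 1 := by
    rw [← abs_mul, ← sum_mul_tripleSum hu hp r i l, ← h1, Finset.mul_sum]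
    refine (Finset.abs_sum_le_sum_abs _ _).trans (Finset.sum_le_sum fun j _ => ?_)
    rw [abs_mul, abs_mul, abs_of_pos (hp j), abs_of_nonneg (hyper i j l)]
    have h3 := hi j (Finset.mem_univ _)
    have h4 := mul_nonneg (hp j).le (hyper i j l)
    nlinarith
  exact le_of_mul_le_mul_left h2 hpos

theorem abs_linForm_le (hu : ∀ r l, |u r l| ≤ 1) {ξ : Fin (k + 1) → ℝ} (hξ : ∀ i, 0 ≤ ξ i)
    (j : Fin (k + 1)) : |linForm u j ξ| ≤ total ξ := by
  refine (Finset.abs_sum_le_sum_abs _ _).trans (Finset.sum_le_sum fun i _ => ?_)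
  rw [abs_mul, abs_of_nonneg (hξ i)]
  exact mul_le_of_le_one_left (hξ i) (hu j i)

theorem abs_prod_linForm_le (hu : ∀ r l, |u r l| ≤ 1) {ξ : Fin (k + 1) → ℝ} (hξ : ∀ i, 0 ≤ ξ i)
    (n : Fin (k + 1) → ℕ) : |∏ j, linForm u j ξ ^ n j| ≤ total ξ ^ size n := by
  rw [Finset.abs_prod, size, ← Finset.prod_pow_eq_pow_sum]
  refine Finset.prod_le_prod (fun j _ => abs_nonneg _) fun j _ => ?_
  rw [abs_pow]
  exact pow_le_pow_left₀ (abs_nonneg _) (abs_linForm_le hu hξ j) _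

theorem abs_prod_linForm_le_one (hu : ∀ r l, |u r l| ≤ 1) {ξ : Fin (k + 1) → ℝ}
    (hξ : ξ ∈ unitSimplex k) (n : Fin (k + 1) → ℕ) : |∏ j, linForm u j ξ ^ n j| ≤ 1 :=
  (abs_prod_linForm_le hu hξ.1 n).trans
    (pow_le_one₀ (Finset.sum_nonneg fun i _ => hξ.1 i) hξ.2)

/-- For a point of the simplex the kernel is non-negative. -/
theorem kernelSum_nonneg (hμ : ∀ i, 0 < μ i) (hu : IsOrthogonalBasis (prob μ) u e)
    (hyper : HypergroupProperty (prob μ) u) {ξ : Fin (k + 1) → ℝ} (hξ : ξ ∈ unitSimplex k)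
    (x y : Fin (k + 1) → ℕ) :
    0 ≤ kernelSum μ u (fun n => ∏ j, linForm u j ξ ^ n j) x y := by
  have hp := prob_pos hμ
  have hms : ConvergesInMeanSquare μ u (fun n => ∏ j, linForm u j ξ ^ n j) :=
    convergesInMeanSquare_of_bounded hμ hu
      (fun n => abs_prod_linForm_le_one (hyper.abs_le_one hu hp) hξ n)
  set c : Fin (k + 1) → ℝ := fun j => linForm u j ξ with hc
  -- p_j κ_ij is the probability that a count in cell i moves to cell j; by `hκ1` it sums over j to
  -- |ξ|.
  set κ : Fin (k + 1) → Fin (k + 1) → ℝ := fun i j =>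
    ∑ m, ξ m * tripleSum (prob μ) u i j m with hκ
  have hκ0 : ∀ i j, 0 ≤ κ i j := fun i j =>
    Finset.sum_nonneg fun m _ => mul_nonneg (hξ.1 m) (hyper i j m)
  have hc0 : c 0 = total ξ := by simp [hc, linForm, hu.zero_eq_one, total]
  have hκ1 : ∀ i, ∑ j, prob μ j * κ i j = c 0 := by
    intro i
    simp only [hκ, hc, linForm, Finset.mul_sum]
    rw [Finset.sum_comm]
    refine Finset.sum_congr rfl fun m _ => ?_
    have h := sum_mul_tripleSum hu hp 0 i m
    simp only [hu.zero_eq_one, mul_one] at h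
    calc ∑ j, prob μ j * (ξ m * tripleSum (prob μ) u i j m)
        = ξ m * ∑ j, prob μ j * tripleSum (prob μ) u i j m := by
          rw [Finset.mul_sum]
          exact Finset.sum_congr rfl fun j _ => by ring
      _ = u 0 m * ξ m := by rw [h, hu.zero_eq_one, mul_comm]
  have hκ2 : ∀ i j, κ i j = ∑ l, (sqNorm (prob μ) u l)⁻¹ * u l i * u l j * c l := by
    intro i j
    simp only [hκ, hc, linForm, tripleSum, Finset.mul_sum]
    rw [Finset.sum_comm]
    exact Finset.sum_congr rfl fun l _ => Finset.sum_congr rfl fun m _ => by ring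
  -- The generating function of the conditional law given X = x: fresh Poisson counts of means (1 -
  -- |ξ|) μ_j, and for each old count either deletion or a move.
  let F : (Fin (k + 1) → ℝ) → ℝ := fun σ =>
    Real.exp (-(1 - c 0) * total μ) * (∏ j, Real.exp ((1 - c 0) * μ j * σ j)) *
      ∏ i, ((1 - c 0) + ∑ j, prob μ j * κ i j * σ j) ^ x i
  have h1c : 0 ≤ 1 - c 0 := by rw [hc0]; linarith [hξ.2]
  have hF : HasNonnegExpansion F := by
    refine ((HasNonnegExpansion.const (Real.exp_pos _).le).mul (.prod _ fun j _ =>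
      .exp_coord j (mul_nonneg h1c (hμ j).le))).mul (.prod _ fun i _ => .pow (.add
        (.const h1c) (.sum _ fun j _ => .mul (.const (mul_nonneg (hp j).le (hκ0 i j)))
          (.coord j))) _)
  have hb : ∀ σ : Fin (k + 1) → ℝ, HasSum (fun y => poissonProb μ y *
      kernelSum μ u (fun n => ∏ j, c j ^ n j) x y * ∏ i, σ i ^ y i) (F σ) := by
    intro σ
    have hφ : Summable fun y : Fin (k + 1) → ℕ => poissonProb μ y * (∏ i, σ i ^ y i) ^ 2 := by
      have h := expGrowth_prod_pow (k := k) σ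
      simpa [sq] using (h.mul h).summable hμ
    obtain ⟨s, h1, h2⟩ := hms.exists_hasSum hμ hu x hφ
    simp only [(hasSum_transform_mvCharlier hμ hu σ _).tsum_eq] at h2
    -- Chosen so that ρ_n h_n times the transform of C_n is w^n up to a factor free of n; the series
    -- over n is then the generating function of the C_n(x) at w.
    set w : Fin (k + 1) → ℝ := fun l =>
      c l * (sgn l * (total μ * dualForm μ u σ l / sqNorm (prob μ) u l)) with hw
    have h3 := (hasSum_mvCharlier μ hu.zero_eq_one x w).mul_left
      (Real.exp (∑ i, μ i * (σ i - 1)))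
    have h4 : s = Real.exp (∑ i, μ i * (σ i - 1)) *
        (Real.exp (w 0) * ∏ i, (1 + (∑ l, sgn l * w l * u l i) / total μ) ^ x i) := by
      refine h2.unique ((hasSum_congr_fun fun n => ?_).2 h3)
      have h5 : hCoeff μ u n * ∏ l, (sgn l * dualForm μ u σ l) ^ n l / (n l).factorial
          = ∏ l, (sgn l * (total μ * dualForm μ u σ l / sqNorm (prob μ) u l)) ^ n l := by
        rw [hCoeff, size, ← Finset.prod_pow_eq_pow_sum, ← Finset.prod_mul_distrib,
          ← Finset.prod_mul_distrib]
        refine Finset.prod_congr rfl fun l _ => ?_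
        have h6 : ((n l).factorial : ℝ) ≠ 0 := by positivity
        simp only [mul_pow, div_pow]
        field_simp
      simp only [hw, mul_pow (c _), Finset.prod_mul_distrib]
      rw [← h5]
      ring
    have h7 : F σ = s := by
      have h8 : w 0 = - c 0 * ∑ j, μ j * (σ j - 1) := by
        simp only [hw, sgn, if_true, hu.sqNorm_zero (sum_prob hμ), div_one, dualForm,
          hu.zero_eq_one, mul_one]
        rw [Finset.mul_sum]
        simp only [← mul_assoc, total_mul_prob hμ]
        ring
      have h9 : ∀ i, 1 + (∑ l, sgn l * w l * u l i) / total μ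
          = (1 - c 0) + ∑ j, prob μ j * κ i j * σ j := by
        intro i
        have h10 : (∑ l, sgn l * w l * u l i) / total μ
            = ∑ j, prob μ j * κ i j * (σ j - 1) := by
          simp only [hκ2, Finset.mul_sum, Finset.sum_mul, Finset.sum_div]
          rw [Finset.sum_comm]
          refine Finset.sum_congr rfl fun l _ => ?_
          have h11 := (total_pos hμ).ne'
          have h12 : sgn l * w l * u l i / total μ
              = (sqNorm (prob μ) u l)⁻¹ * c l * u l i * dualForm μ u σ l := by
            have h13 := sgn_mul_self l
            simp only [hw]
            field_simp
            linear_combination ((sqNorm (prob μ) u l)⁻¹ * c l * dualForm μ u σ l * u l i) * h13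
          rw [h12, dualForm, Finset.mul_sum]
          exact Finset.sum_congr rfl fun j _ => by ring
        rw [h10, ← hκ1 i]
        simp only [mul_sub, mul_one, Finset.sum_sub_distrib]
        ring
      have h14 : -(1 - c 0) * total μ + ∑ j, (1 - c 0) * μ j * σ j
          = ∑ j, μ j * (σ j - 1) + w 0 := by
        have h15 : ∑ j, μ j * (σ j - 1) = ∑ j, μ j * σ j - total μ := by
          simp [mul_sub, total]
        have h16 : ∑ j, (1 - c 0) * μ j * σ j = (1 - c 0) * ∑ j, μ j * σ j := by
          rw [Finset.mul_sum]
          exact Finset.sum_congr rfl fun j _ => by ring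
        rw [h8, h15, h16]
        ring
      rw [h4, ← mul_assoc, ← Real.exp_add, ← h14, Real.exp_add, Real.exp_sum]
      simp only [h9, F]
    rw [h7]
    exact (hasSum_congr_fun fun y => by ring).2 h1
  exact nonneg_of_mul_nonneg_right (hF.coeff_nonneg hb y) (poissonProb_pos hμ y)

theorem continuous_linForm (u : Fin (k + 1) → Fin (k + 1) → ℝ) (j : Fin (k + 1)) :
    Continuous (linForm u j) := by
  unfold linForm
  fun_prop

theorem HasMomentRepresentation.abs_le_one (h : HasMomentRepresentation u ρ)
    (hu : ∀ r l, |u r l| ≤ 1) (n : Fin (k + 1) → ℕ) : |ρ n| ≤ 1 := by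
  obtain ⟨ν, hν, hs, hn⟩ := h
  rw [hn n]
  have h1 := norm_integral_le_of_norm_le_const (μ := ν) (C := 1)
    (f := fun ξ => ∏ j, linForm u j ξ ^ n j) (hs.mono fun ξ hξ => abs_prod_linForm_le_one hu hξ n)
  simpa using h1

/-- A representable array gives a non-negative expansion. -/
theorem HasMomentRepresentation.expansion_nonneg (hμ : ∀ i, 0 < μ i)
    (hu : IsOrthogonalBasis (prob μ) u e) (hyper : HypergroupProperty (prob μ) u)
    (hρ0 : ρ 0 = 1) (h : HasMomentRepresentation u ρ) (x y : Fin (k + 1) → ℕ) :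
    0 ≤ expansion μ u ρ x y := by
  have hu1 := hyper.abs_le_one hu (prob_pos hμ)
  have hms := convergesInMeanSquare_of_bounded hμ hu (h.abs_le_one hu1)
  rw [expansion_eq hu.zero_eq_one hρ0 (hms.summable_expansionTerm hμ hu x y)]
  refine mul_nonneg (mul_nonneg (poissonProb_pos hμ x).le (poissonProb_pos hμ y).le) ?_
  obtain ⟨ν, hν, hs, hn⟩ := h
  -- The expansion with all ρ_n = 1 dominates, since the products of linear forms are at most 1 on
  -- the simplex; this permits integrating over ξ term by term.
  set B : (Fin (k + 1) → ℕ) → ℝ := fun n => |hCoeff μ u n * mvCharlier μ u n x * mvCharlier μ u n y|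
    with hB
  have hBs : Summable B := by
    have h1 := ((convergesInMeanSquare_of_bounded (ρ := fun _ => 1) (K := 1) hμ hu
      (by simp)).summable_expansionTerm hμ hu x y).abs
    refine h1.congr fun n => ?_
    simp [hB, expansionTerm]
  have h2 : HasSum (fun n => ∫ ξ, expansionTerm μ u (fun n => ∏ j, linForm u j ξ ^ n j) x y n ∂ν)
      (∫ ξ, kernelSum μ u (fun n => ∏ j, linForm u j ξ ^ n j) x y ∂ν) := by
    refine hasSum_integral_of_dominated_convergence (fun n _ => B n) (fun n => ?_) (fun n => ?_)
      (.of_forall fun _ => hBs) (integrable_const _) ?_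
    · refine Continuous.aestronglyMeasurable ?_
      have := continuous_linForm u
      unfold expansionTerm
      fun_prop
    · filter_upwards [hs] with ξ hξ
      rw [expansionTerm, mul_assoc, mul_assoc, norm_mul, hB, ← mul_assoc (hCoeff μ u n)]
      exact mul_le_of_le_one_left (abs_nonneg _) (abs_prod_linForm_le_one hu1 hξ n)
    · filter_upwards [hs] with ξ hξ
      exact ((convergesInMeanSquare_of_bounded hμ hu fun n =>
        abs_prod_linForm_le_one hu1 hξ n).summable_expansionTerm hμ hu x y).hasSum
  have h3 : kernelSum μ u ρ x y = ∫ ξ, kernelSum μ u (fun n => ∏ j, linForm u j ξ ^ n j) x y ∂ν := by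
    rw [← h2.tsum_eq]
    refine tsum_congr fun n => ?_
    simp only [expansionTerm, integral_mul_const]
    rw [← hn n]
  rw [h3]
  refine integral_nonneg_of_ae ?_
  filter_upwards [hs] with ξ hξ
  exact kernelSum_nonneg hμ hu hyper hξ x y

end Representable

open Asymptotics

/-! ### Leading terms of the C_n, with bounds holding at every y (the filter `⊤`). -/

section Growth

variable {k : ℕ}

/-- The vector `y - e_i`, truncated at `0`. -/
abbrev lower {d : ℕ} (y : Fin d → ℕ) (i : Fin d) : Fin d → ℕ := y - Pi.single i 1

/-- The weight `1 + |y|` in which the growth of polynomials is measured. -/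
def growthWeight (y : Fin (k + 1) → ℕ) : ℝ := 1 + size y

theorem growthWeight_pos (y : Fin (k + 1) → ℕ) : 0 < growthWeight y := by
  unfold growthWeight
  positivity

theorem one_le_growthWeight (y : Fin (k + 1) → ℕ) : 1 ≤ growthWeight y := by
  unfold growthWeight
  linarith [(Nat.cast_nonneg (size y) : (0 : ℝ) ≤ _)]

/-- Both functions grow at most like the `r`-th power of `1 + |y|`, and their difference by one
order less. -/
structure SameLeading (r : ℕ) (f g : (Fin (k + 1) → ℕ) → ℝ) : Prop where
  left : f =O[⊤] fun y => growthWeight y ^ r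
  right : g =O[⊤] fun y => growthWeight y ^ r
  diff : (fun y => (f y - g y) * growthWeight y) =O[⊤] fun y => growthWeight y ^ r

variable {r s : ℕ} {f g f' g' : (Fin (k + 1) → ℕ) → ℝ}

theorem SameLeading.symm (h : SameLeading r f g) : SameLeading r g f :=
  ⟨h.right, h.left, by
    have h1 := h.diff.neg_left
    refine h1.congr_left fun y => by ring⟩

theorem SameLeading.trans (h : SameLeading r f g) (h' : SameLeading r g f') :
    SameLeading r f f' :=
  ⟨h.left, h'.right, (h.diff.add h'.diff).congr_left fun y => by ring⟩

theorem SameLeading.mul (h : SameLeading r f g) (h' : SameLeading s f' g') :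
    SameLeading (r + s) (fun y => f y * f' y) (fun y => g y * g' y) := by
  refine ⟨?_, ?_, ?_⟩
  · simpa only [pow_add] using h.left.mul h'.left
  · simpa only [pow_add] using h.right.mul h'.right
  · have h1 := (h.left.mul h'.diff).add (h.diff.mul h'.right)
    simp only [pow_add]
    exact h1.congr_left fun y => by ring

theorem SameLeading.add (h : SameLeading r f g) (h' : SameLeading r f' g') :
    SameLeading r (fun y => f y + f' y) (fun y => g y + g' y) :=
  ⟨h.left.add h'.left, h.right.add h'.right, (h.diff.add h'.diff).congr_left fun y => by ring⟩

theorem SameLeading.const_mul (h : SameLeading r f g) (c : ℝ) :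
    SameLeading r (fun y => c * f y) (fun y => c * g y) :=
  ⟨h.left.const_mul_left c, h.right.const_mul_left c,
    (h.diff.const_mul_left c).congr_left fun y => by ring⟩

theorem SameLeading.refl (h : f =O[⊤] fun y => growthWeight y ^ r) : SameLeading r f f :=
  ⟨h, h, (isBigO_zero _ _).congr_left fun y => by ring⟩

theorem SameLeading.const (c : ℝ) : SameLeading (k := k) 0 (fun _ => c) (fun _ => c) :=
  .refl (by simpa using isBigO_const_const c (one_ne_zero (α := ℝ)) _)

theorem SameLeading.sum {ι : Type*} (t : Finset ι) {F G : ι → (Fin (k + 1) → ℕ) → ℝ}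
    (h : ∀ i, SameLeading r (F i) (G i)) :
    SameLeading r (fun y => ∑ i ∈ t, F i y) (fun y => ∑ i ∈ t, G i y) := by
  classical
  induction t using Finset.induction_on with
  | empty => simpa using SameLeading.refl (isBigO_zero _ _)
  | insert i t hi ih =>
    simp only [Finset.sum_insert hi]
    exact (h i).add ih

theorem SameLeading.prod {ι : Type*} (t : Finset ι) {q : ι → ℕ}
    {F G : ι → (Fin (k + 1) → ℕ) → ℝ} (h : ∀ i, SameLeading (q i) (F i) (G i)) :
    SameLeading (∑ i ∈ t, q i) (fun y => ∏ i ∈ t, F i y) (fun y => ∏ i ∈ t, G i y) := by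
  classical
  induction t using Finset.induction_on with
  | empty => simpa using SameLeading.const (k := k) 1
  | insert i t hi ih =>
    simp only [Finset.prod_insert hi, Finset.sum_insert hi]
    exact (h i).mul ih

theorem SameLeading.pow (h : SameLeading 1 f g) (m : ℕ) :
    SameLeading m (fun y => f y ^ m) (fun y => g y ^ m) := by
  simpa using SameLeading.prod (Finset.range m) (q := fun _ => 1) (F := fun _ => f)
    (G := fun _ => g) fun _ => h

theorem isBigO_growthWeight_pow_of_le (h : r ≤ s) :
    (fun y : Fin (k + 1) → ℕ => growthWeight y ^ r) =O[⊤] fun y => growthWeight y ^ s := by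
  refine isBigO_top.2 ⟨1, fun y => ?_⟩
  have h1 := (growthWeight_pos y).le
  rw [one_mul, Real.norm_of_nonneg (by positivity), Real.norm_of_nonneg (by positivity)]
  exact pow_le_pow_right₀ (one_le_growthWeight y) h

/-- Functions of lower order are negligible. -/
theorem SameLeading.of_lt (h : f =O[⊤] fun y => growthWeight y ^ r) (hrs : r < s) :
    SameLeading s f (fun _ => 0) := by
  refine ⟨h.trans (isBigO_growthWeight_pow_of_le hrs.le), isBigO_zero _ _, ?_⟩
  have h1 := h.mul (isBigO_refl (fun y : Fin (k + 1) → ℕ => growthWeight y) ⊤)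
  simp only [← pow_succ] at h1
  exact (h1.trans (isBigO_growthWeight_pow_of_le hrs)).congr_left fun y => by ring

theorem isBigO_size : (fun y : Fin (k + 1) → ℕ => (size y : ℝ)) =O[⊤] fun y => growthWeight y ^ 1 :=
  isBigO_top.2 ⟨1, fun y => by
    have h := (Nat.cast_nonneg (size y) : (0 : ℝ) ≤ _)
    rw [pow_one, one_mul, Real.norm_of_nonneg h, Real.norm_of_nonneg (growthWeight_pos y).le,
      growthWeight]
    linarith⟩

theorem isBigO_coord (i : Fin (k + 1)) :
    (fun y : Fin (k + 1) → ℕ => (y i : ℝ)) =O[⊤] fun y => growthWeight y ^ 1 := by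
  refine IsBigO.trans (isBigO_top.2 ⟨1, fun y => ?_⟩) isBigO_size
  rw [one_mul, Real.norm_of_nonneg (Nat.cast_nonneg _), Real.norm_of_nonneg (Nat.cast_nonneg _)]
  exact_mod_cast Finset.single_le_sum (f := y) (fun j _ => Nat.zero_le _) (Finset.mem_univ i)

theorem SameLeading.size_sub (c : ℝ) :
    SameLeading (k := k) 1 (fun y => (size y : ℝ) - c) (fun y => (size y : ℝ)) := by
  have h := (SameLeading.refl (k := k) isBigO_size).add
    (.of_lt (SameLeading.const (k := k) (-c)).left zero_lt_one)
  simpa [← sub_eq_add_neg] using h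

theorem SameLeading.size_growthWeight :
    SameLeading (k := k) 1 (fun y => (size y : ℝ)) growthWeight := by
  have h := SameLeading.size_sub (k := k) (-1)
  simp only [sub_neg_eq_add, add_comm _ (1 : ℝ)] at h
  exact h.symm

theorem SameLeading.descPochhammer (c : ℝ) (m : ℕ) :
    SameLeading (k := k) m (fun y => (descPochhammer ℝ m).eval ((size y : ℝ) - c))
      (fun y => (size y : ℝ) ^ m) := by
  induction m with
  | zero => simpa using SameLeading.const (k := k) 1
  | succ m ih =>
    simp only [descPochhammer_succ_eval, pow_succ, sub_sub]
    exact ih.mul (.size_sub _)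

theorem SameLeading.charlier (m : ℕ) (c a : ℝ) :
    SameLeading (k := k) m (fun y => charlier m ((size y : ℝ) - c) a)
      (fun y => (-a⁻¹) ^ m * (size y : ℝ) ^ m) := by
  have h1 : SameLeading (k := k) m (fun y => ∑ i ∈ Finset.range m,
      (m.choose i : ℝ) * (-a⁻¹) ^ i * (_root_.descPochhammer ℝ i).eval ((size y : ℝ) - c))
      (fun _ => 0) := by
    have h2 : ∀ i : Finset.range m, SameLeading (k := k) m (fun y =>
        (m.choose i : ℝ) * (-a⁻¹) ^ (i : ℕ) *
          (_root_.descPochhammer ℝ i).eval ((size y : ℝ) - c)) (fun _ => 0) := fun i =>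
      .of_lt ((SameLeading.descPochhammer c i).left.const_mul_left _) (Finset.mem_range.1 i.2)
    have h3 := SameLeading.sum Finset.univ h2
    simp only [Finset.univ_eq_attach, Finset.sum_const_zero] at h3
    refine cast (congrArg (fun F => SameLeading m F fun _ => 0) (funext fun y => ?_)) h3
    exact Finset.sum_attach _ fun i => (m.choose i : ℝ) * (-a⁻¹) ^ (i : ℕ) *
          (_root_.descPochhammer ℝ i).eval ((size y : ℝ) - c)
  have h4 := h1.add ((SameLeading.descPochhammer (k := k) c m).const_mul ((-a⁻¹) ^ m))
  simp only [zero_add] at h4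
  refine cast (congrArg (fun F => SameLeading m F _) (funext fun y => ?_)) h4
  rw [PoissonLancaster.charlier, Finset.sum_range_succ, Nat.choose_self, Nat.cast_one, one_mul]

/-- A linear form on vectors of counts. -/
def countForm (u : Fin (k + 1) → Fin (k + 1) → ℝ) (j : Fin (k + 1)) (y : Fin (k + 1) → ℕ) : ℝ :=
  linForm u j fun i => (y i : ℝ)

theorem growthWeight_le_shift (i : Fin (k + 1)) (y : Fin (k + 1) → ℕ) :
    growthWeight (lower y i) ≤ growthWeight y ∧
      growthWeight y ≤ 2 * growthWeight (lower y i) := by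
  have h1 : size (lower y i) ≤ size y :=
    Finset.sum_le_sum fun j _ => Nat.sub_le _ _
  have h2 : size y ≤ size (lower y i) + 1 := by
    have : size (lower y i) + 1 = ∑ j, (lower y i j + (Pi.single i 1 : Fin (k + 1) → ℕ) j) := by
      rw [Finset.sum_add_distrib, size]
      simp
    rw [this]
    exact Finset.sum_le_sum fun j _ => by simp only [Pi.sub_apply]; omega
  have h1 : (size (lower y i) : ℝ) ≤ size y := by exact_mod_cast h1
  have h2 : (size y : ℝ) ≤ size (lower y i) + 1 := by exact_mod_cast h2
  have h3 := (Nat.cast_nonneg (size (lower y i)) : (0 : ℝ) ≤ _)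
  unfold growthWeight
  constructor <;> linarith

/-- The weights at y and at y - e_i differ at most by a factor 2. -/
theorem SameLeading.shift (h : SameLeading r f g) (i : Fin (k + 1)) :
    SameLeading r (fun y => f (lower y i)) (fun y => g (lower y i)) := by
  have hw : (fun y : Fin (k + 1) → ℕ => growthWeight (lower y i) ^ r) =O[⊤]
      fun y => growthWeight y ^ r := by
    refine isBigO_top.2 ⟨1, fun y => ?_⟩
    have h1 := (growthWeight_pos y).le
    have h2 := (growthWeight_pos (lower y i)).le
    rw [one_mul, Real.norm_of_nonneg (by positivity), Real.norm_of_nonneg (by positivity)]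
    exact pow_le_pow_left₀ h2 (growthWeight_le_shift i y).1 r
  have hw' : (fun y : Fin (k + 1) → ℕ => growthWeight y) =O[⊤]
      fun y => growthWeight (lower y i) := by
    refine isBigO_top.2 ⟨2, fun y => ?_⟩
    rw [Real.norm_of_nonneg (growthWeight_pos y).le, Real.norm_of_nonneg (growthWeight_pos _).le]
    exact (growthWeight_le_shift i y).2
  have hc {φ ψ : (Fin (k + 1) → ℕ) → ℝ} (h : φ =O[⊤] ψ) :
      (fun y => φ (lower y i)) =O[⊤] fun y => ψ (lower y i) :=
    h.comp_tendsto Filter.tendsto_top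
  refine ⟨(hc h.left).trans hw, (hc h.right).trans hw, ?_⟩
  exact ((isBigO_refl _ _).mul hw').trans ((hc h.diff).trans hw)

theorem SameLeading.countForm_shift (u : Fin (k + 1) → Fin (k + 1) → ℝ) (j i : Fin (k + 1)) :
    SameLeading 1 (fun y => countForm u j (lower y i)) (countForm u j) := by
  have h : ∀ l, SameLeading (k := k) 1 (fun y => u j l * ((lower y i l : ℕ) : ℝ))
      (fun y => u j l * (y l : ℝ)) := by
    intro l
    refine SameLeading.const_mul ?_ _
    have h1 := (SameLeading.refl (isBigO_coord l)).shift i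
    refine ⟨h1.left, isBigO_coord l, ?_⟩
    refine isBigO_top.2 ⟨1, fun y => ?_⟩
    rw [pow_one, norm_mul]
    refine mul_le_mul_of_nonneg_right ?_ (norm_nonneg _)
    have h2 : lower y i l ≤ y l := Nat.sub_le _ _
    have h3 : y l ≤ lower y i l + 1 := by
      have : (Pi.single i 1 : Fin (k + 1) → ℕ) l ≤ 1 := by
        rw [Pi.single_apply]
        split_ifs <;> simp
      simp only [Pi.sub_apply]
      omega
    have h2 : ((lower y i l : ℕ) : ℝ) ≤ y l := by exact_mod_cast h2
    have h3 : (y l : ℝ) ≤ (lower y i l : ℕ) + 1 := by exact_mod_cast h3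
    rw [Real.norm_eq_abs, abs_le]
    constructor <;> linarith
  exact SameLeading.sum Finset.univ h

theorem derivation_prod {R A ι : Type*} [CommRing R] [CommRing A] [Algebra R A] [DecidableEq ι]
    (D : Derivation R A A) (t : Finset ι) (F : ι → A) :
    D (∏ i ∈ t, F i) = ∑ i ∈ t, D (F i) * ∏ j ∈ t.erase i, F j := by
  induction t using Finset.induction_on with
  | empty => simp
  | insert a t ha ih =>
    rw [Finset.prod_insert ha, D.leibniz, ih, Finset.sum_insert ha, Finset.erase_insert ha,
      smul_eq_mul, smul_eq_mul, Finset.mul_sum, add_comm, mul_comm]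
    congr 1
    refine Finset.sum_congr rfl fun i hi => ?_
    have hne : a ≠ i := fun h => ha (h ▸ hi)
    rw [Finset.erase_insert_of_ne hne, Finset.prod_insert (by simp [ha])]
    ring

/-- Differentiating in w_l lowers one exponent x_i. When x_i = 0 the truncation does not matter, as
the factor x_i vanishes. -/
theorem pderiv_krawtchoukGen (v : Fin (k + 1) → Fin (k + 1) → ℝ) (x : Fin (k + 1) → ℕ)
    (l : Fin k) : MvPolynomial.pderiv l (krawtchoukGen v x) =
      ∑ i, MvPolynomial.C (x i * v l.succ i) * krawtchoukGen v (lower x i) := by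
  classical
  rw [krawtchoukGen, derivation_prod]
  refine Finset.sum_congr rfl fun i _ => ?_
  have h1 : MvPolynomial.pderiv l (1 + ∑ l : Fin k,
      MvPolynomial.C (v l.succ i) * (MvPolynomial.X l : MvPolynomial (Fin k) ℝ))
      = MvPolynomial.C (v l.succ i) := by
    simp [MvPolynomial.pderiv_X, Pi.single_apply]
  rw [Derivation.leibniz_pow, h1, krawtchoukGen, ← Finset.mul_prod_erase _ _ (Finset.mem_univ i)]
  have h2 : ∀ j ∈ Finset.univ.erase i, (1 + ∑ l : Fin k, MvPolynomial.C (v l.succ j) *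
      (MvPolynomial.X l : MvPolynomial (Fin k) ℝ)) ^ lower x i j
      = (1 + ∑ l : Fin k, MvPolynomial.C (v l.succ j) * MvPolynomial.X l) ^ x j := by
    intro j hj
    simp [Finset.ne_of_mem_erase hj]
  rw [Finset.prod_congr rfl h2]
  simp only [Pi.sub_apply, Pi.single_eq_same, nsmul_eq_mul, smul_eq_mul, map_mul, map_natCast]
  ring

theorem krawtchouk_add_single (v : Fin (k + 1) → Fin (k + 1) → ℝ) (x : Fin (k + 1) → ℕ)
    (m : Fin k → ℕ) (l : Fin k) : krawtchouk v (m + Pi.single l 1) x * (m l + 1) =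
      ∑ i, v l.succ i * (x i * krawtchouk v m (lower x i)) := by
  classical
  have h1 : Finsupp.equivFunOnFinite.symm (m + Pi.single l 1)
      = Finsupp.equivFunOnFinite.symm m + Finsupp.single l 1 := by
    ext j
    simp [Finsupp.single_apply, Pi.single_apply, eq_comm]
  have h2 := congrArg (MvPolynomial.coeff (Finsupp.equivFunOnFinite.symm m))
    (pderiv_krawtchoukGen v x l)
  rw [MvPolynomial.coeff_pderiv, ← h1, MvPolynomial.coeff_sum] at h2
  simp only [MvPolynomial.coeff_C_mul, ← krawtchouk_eq_coeff] at h2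
  refine Eq.trans ?_ (h2.trans (Finset.sum_congr rfl fun i _ => by ring))
  simp

theorem krawtchouk_zero (v : Fin (k + 1) → Fin (k + 1) → ℝ) (x : Fin (k + 1) → ℕ) :
    krawtchouk v 0 x = 1 := by
  rw [krawtchouk_eq_coeff, krawtchoukGen]
  have : Finsupp.equivFunOnFinite.symm (0 : Fin k → ℕ) = 0 := by ext; simp
  rw [this, ← MvPolynomial.constantCoeff_eq]
  simp

/-- The leading term of the Krawtchouk polynomials. -/
theorem SameLeading.krawtchouk (v : Fin (k + 1) → Fin (k + 1) → ℝ) (m : Fin k → ℕ) :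
    SameLeading (size m) (krawtchouk v m)
      (fun y => ∏ l, ((m l).factorial : ℝ)⁻¹ * countForm v l.succ y ^ m l) := by
  classical
  induction hN : size m generalizing m with
  | zero =>
    have hm : m = 0 := by
      funext l
      exact (Finset.sum_eq_zero_iff.1 hN) l (Finset.mem_univ l)
    subst hm
    have h : PoissonLancaster.krawtchouk v 0 = fun _ => 1 := funext (krawtchouk_zero v)
    simpa [h] using SameLeading.const (k := k) 1
  | succ N ih =>
    obtain ⟨l, hl⟩ : ∃ l, m l ≠ 0 := by
      by_contra! h
      simp [size, h] at hN
    obtain ⟨m', rfl⟩ : ∃ m' : Fin k → ℕ, m = m' + Pi.single l 1 := by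
      refine ⟨lower m l, funext fun j => ?_⟩
      change m j = m j - (Pi.single l 1 : Fin k → ℕ) j + (Pi.single l 1 : Fin k → ℕ) j
      rw [Pi.single_apply]
      split_ifs with h
      · subst h
        omega
      · omega
    have hN' : size m' = N := by
      simp only [size, Pi.add_apply, Finset.sum_add_distrib] at hN
      simpa [size] using hN
    have h1 : SameLeading N (fun y => ∏ l, ((m' l).factorial : ℝ)⁻¹ * countForm v l.succ y ^ m' l)
        (fun y => ∏ l, ((m' l).factorial : ℝ)⁻¹ * countForm v l.succ y ^ m' l) :=
      .refl (ih m' hN').right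
    -- In the recurrence that raises the index l, passing from y - e_i back to y costs only
    -- lower-order terms; the weights v_i y_i then sum to one more linear form.
    have h2 (i : Fin (k + 1)) : SameLeading N
        (fun y => ∏ l, ((m' l).factorial : ℝ)⁻¹ * countForm v l.succ (lower y i) ^ m' l)
        (fun y => ∏ l, ((m' l).factorial : ℝ)⁻¹ * countForm v l.succ y ^ m' l) := by
      rw [← hN']
      exact SameLeading.prod Finset.univ fun l =>
        ((SameLeading.countForm_shift v l.succ i).pow (m' l)).const_mul _
    have h3 (i : Fin (k + 1)) := (((SameLeading.refl (isBigO_coord i)).mul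
      (((ih m' hN').shift i).trans (h2 i))).const_mul (v l.succ i))
    have h4 := (SameLeading.sum Finset.univ h3).const_mul ((m' l : ℝ) + 1)⁻¹
    rw [add_comm 1 N] at h4
    have hne : (m' l : ℝ) + 1 ≠ 0 := by positivity
    have e1 : PoissonLancaster.krawtchouk v (m' + Pi.single l 1) = fun y => ((m' l : ℝ) + 1)⁻¹ *
        ∑ i, v l.succ i * (y i * PoissonLancaster.krawtchouk v m' (lower y i)) := by
      funext y
      rw [← krawtchouk_add_single]
      field_simp
    have e2 : (fun y => ∏ j, (((m' + Pi.single l 1 : Fin k → ℕ) j).factorial : ℝ)⁻¹ *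
        countForm v j.succ y ^ (m' + Pi.single l 1 : Fin k → ℕ) j) = fun y => ((m' l : ℝ) + 1)⁻¹ *
        ∑ i, v l.succ i * (y i *
          ∏ l, ((m' l).factorial : ℝ)⁻¹ * countForm v l.succ y ^ m' l) := by
      funext y
      have h5 : ∑ i, v l.succ i * (y i *
          ∏ l, ((m' l).factorial : ℝ)⁻¹ * countForm v l.succ y ^ m' l)
          = countForm v l.succ y *
            ∏ l, ((m' l).factorial : ℝ)⁻¹ * countForm v l.succ y ^ m' l := by
        rw [countForm, linForm, Finset.sum_mul]
        exact Finset.sum_congr rfl fun i _ => by ring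
      rw [h5, ← mul_assoc, ← Finset.mul_prod_erase _ _ (Finset.mem_univ l),
        ← Finset.mul_prod_erase Finset.univ (fun l => ((m' l).factorial : ℝ)⁻¹ *
          countForm v l.succ y ^ m' l) (Finset.mem_univ l), ← mul_assoc]
      congr 1
      · simp only [Pi.add_apply, Pi.single_eq_same, Nat.factorial_succ]
        push_cast
        rw [pow_succ, mul_inv]
        ring
      · refine Finset.prod_congr rfl fun j hj => ?_
        simp [Finset.ne_of_mem_erase hj]
    rw [e1, e2]
    exact h4

/-- The leading coefficient of `C_n`. -/
def leadCoeff (μ : Fin (k + 1) → ℝ) (n : Fin (k + 1) → ℕ) : ℝ :=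
  ∏ l, ((n l).factorial : ℝ)⁻¹ * (sgn l / total μ) ^ n l

theorem leadCoeff_ne_zero {μ : Fin (k + 1) → ℝ} (hμ : ∀ i, 0 < μ i) (n : Fin (k + 1) → ℕ) :
    leadCoeff μ n ≠ 0 := by
  refine Finset.prod_ne_zero_iff.2 fun l _ => ?_
  have h1 := (total_pos hμ).ne'
  have h2 : (sgn l : ℝ) ≠ 0 := fun h => by simpa [h] using sgn_mul_self l
  positivity

/-- The leading term of `C_n`. -/
theorem SameLeading.mvCharlier (μ : Fin (k + 1) → ℝ) {u : Fin (k + 1) → Fin (k + 1) → ℝ}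
    (hu : ∀ i, u 0 i = 1) (n : Fin (k + 1) → ℕ) :
    SameLeading (size n) (mvCharlier μ u n)
      (fun y => leadCoeff μ n * ∏ l, countForm u l y ^ n l) := by
  have h1 := ((SameLeading.charlier (k := k) (n 0) (size (Fin.tail n) : ℝ) (total μ)).mul
    (SameLeading.krawtchouk u (Fin.tail n))).const_mul
      (((n 0).factorial : ℝ)⁻¹ * (total μ ^ size (Fin.tail n))⁻¹)
  have e0 : n 0 + size (Fin.tail n) = size n := by
    rw [size, size, Fin.sum_univ_succ]
    rfl
  rw [e0] at h1
  have e1 : PoissonLancaster.mvCharlier μ u n = fun y =>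
      ((n 0).factorial : ℝ)⁻¹ * (total μ ^ size (Fin.tail n))⁻¹ *
        (PoissonLancaster.charlier (n 0) ((size y : ℝ) - size (Fin.tail n)) (total μ) *
          PoissonLancaster.krawtchouk u (Fin.tail n) y) := by
    funext y
    rw [PoissonLancaster.mvCharlier]
    ring
  have e2 : (fun y => leadCoeff μ n * ∏ l, countForm u l y ^ n l) = fun y =>
      ((n 0).factorial : ℝ)⁻¹ * (total μ ^ size (Fin.tail n))⁻¹ *
        ((-(total μ)⁻¹) ^ n 0 * (size y : ℝ) ^ n 0 *
          ∏ l, ((Fin.tail n l).factorial : ℝ)⁻¹ * countForm u l.succ y ^ Fin.tail n l) := by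
    funext y
    have h2 : countForm u 0 y = size y := by simp [countForm, linForm, hu, size]
    have h3 : (total μ ^ size (Fin.tail n))⁻¹ = ∏ l : Fin k, (1 / total μ) ^ n l.succ := by
      rw [Finset.prod_pow_eq_pow_sum, one_div, inv_pow]
      rfl
    rw [h3, leadCoeff, Fin.prod_univ_succ, Fin.prod_univ_succ (fun l => countForm u l y ^ n l), h2]
    simp only [sgn, if_true, Fin.succ_ne_zero, if_false, Finset.prod_mul_distrib, Fin.tail,
      neg_div, one_div]
    ring
  rw [e1, e2]
  exact h1

end Growth

open Asymptotics Filter Topology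

/-! ### Compactness: limits of moments are moments on the simplex. -/

section Limit

variable {k : ℕ}

theorem isCompact_unitSimplex (k : ℕ) : IsCompact (unitSimplex k) := by
  have hclosed : IsClosed (unitSimplex k) := by
    have h : unitSimplex k = (⋂ i, {ξ | 0 ≤ ξ i}) ∩ {ξ | total ξ ≤ 1} := by
      ext ξ
      simp [unitSimplex]
    rw [h]
    refine (isClosed_iInter fun i => isClosed_le continuous_const (continuous_apply i)).inter
      (isClosed_le ?_ continuous_const)
    unfold total
    fun_prop
  refine (isCompact_Icc (a := (0 : Fin (k + 1) → ℝ)) (b := 1)).of_isClosed_subset hclosed ?_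
  intro ξ hξ
  exact ⟨hξ.1, fun i => (Finset.single_le_sum (fun j _ => hξ.1 j) (Finset.mem_univ i)).trans hξ.2⟩

/-- The radial retraction onto the unit simplex. -/
def simplexRetract (ξ : Fin (k + 1) → ℝ) : Fin (k + 1) → ℝ := (max 1 (total ξ))⁻¹ • ξ

theorem simplexRetract_mem {ξ : Fin (k + 1) → ℝ} (hξ : ∀ i, 0 ≤ ξ i) :
    simplexRetract ξ ∈ unitSimplex k := by
  have h1 : 0 < max 1 (total ξ) := lt_max_of_lt_left one_pos
  refine ⟨fun i => mul_nonneg (inv_pos.2 h1).le (hξ i), ?_⟩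
  have h2 : total (simplexRetract ξ) = (max 1 (total ξ))⁻¹ * total ξ := by
    simp [total, simplexRetract, Finset.mul_sum]
  rw [h2, inv_mul_le_one₀ h1]
  exact le_max_right _ _

theorem prod_linForm_smul (u : Fin (k + 1) → Fin (k + 1) → ℝ) (c : ℝ) (ξ : Fin (k + 1) → ℝ)
    (n : Fin (k + 1) → ℕ) :
    ∏ j, linForm u j (c • ξ) ^ n j = c ^ size n * ∏ j, linForm u j ξ ^ n j := by
  have h (j : Fin (k + 1)) : linForm u j (c • ξ) = c * linForm u j ξ := by
    simp only [linForm, Pi.smul_apply, smul_eq_mul, Finset.mul_sum]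
    exact Finset.sum_congr rfl fun i _ => by ring
  simp only [h, mul_pow, Finset.prod_mul_distrib, Finset.prod_pow_eq_pow_sum]
  rfl

/-- The retraction changes a product of linear forms by little when the moments of the total
are bounded. -/
theorem abs_prod_linForm_simplexRetract_sub_le {u : Fin (k + 1) → Fin (k + 1) → ℝ}
    (hu : ∀ r l, |u r l| ≤ 1) {ξ : Fin (k + 1) → ℝ} (hξ : ∀ i, 0 ≤ ξ i) (n : Fin (k + 1) → ℕ)
    {m : ℕ} (hm : 0 < m) :
    |∏ j, linForm u j (simplexRetract ξ) ^ n j - ∏ j, linForm u j ξ ^ n j|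
      ≤ (m : ℝ)⁻¹ * total ξ ^ (size n * m) := by
  have hm' : (0 : ℝ) < m := by exact_mod_cast hm
  have hS : 0 ≤ total ξ := Finset.sum_nonneg fun i _ => hξ i
  rw [simplexRetract, prod_linForm_smul]
  rcases le_total (total ξ) 1 with h | h
  · rw [max_eq_left h, inv_one, one_pow, one_mul, sub_self, abs_zero]
    positivity
  · rw [max_eq_right h]
    have h1 := abs_prod_linForm_le hu hξ n
    have h2 : 0 < total ξ := by linarith
    have h3 : 1 ≤ total ξ ^ size n := one_le_pow₀ h
    have h4 : (total ξ)⁻¹ ^ size n ≤ 1 := pow_le_one₀ (by positivity) (inv_le_one_of_one_le₀ h)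
    have h5 : (total ξ)⁻¹ ^ size n * ∏ j, linForm u j ξ ^ n j - ∏ j, linForm u j ξ ^ n j
        = -((1 - (total ξ)⁻¹ ^ size n) * ∏ j, linForm u j ξ ^ n j) := by ring
    rw [h5, abs_neg, abs_mul, abs_of_nonneg (sub_nonneg.2 h4)]
    have h6 : (1 - (total ξ)⁻¹ ^ size n) * |∏ j, linForm u j ξ ^ n j|
        ≤ (1 - (total ξ)⁻¹ ^ size n) * total ξ ^ size n :=
      mul_le_mul_of_nonneg_left h1 (sub_nonneg.2 h4)
    have h7 : (1 - (total ξ)⁻¹ ^ size n) * total ξ ^ size n = total ξ ^ size n - 1 := by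
      rw [sub_mul, one_mul, inv_pow, inv_mul_cancel₀ (by positivity)]
    -- Bernoulli's inequality m(T - 1) ≤ T^m - 1 for T = |ξ|^{|n|}: a high moment controls the
    -- excess over the simplex with a gain 1/m.
    have h8 := one_add_mul_le_pow (a := total ξ ^ size n - 1) (by linarith) m
    rw [add_sub_cancel, ← pow_mul] at h8
    rw [h7] at h6
    refine h6.trans ?_
    rw [inv_mul_eq_div, le_div_iff₀ hm']
    linarith

/-- A limit theorem: if the moments of laws on the non-negative orthant converge to a bounded
array, then that array consists of the moments of a law on the unit simplex. -/
theorem hasMomentRepresentation_of_tendsto {u : Fin (k + 1) → Fin (k + 1) → ℝ}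
    (hu : ∀ r l, |u r l| ≤ 1) (hu0 : ∀ i, u 0 i = 1) {ρ : (Fin (k + 1) → ℕ) → ℝ}
    (hρ : ∀ n, |ρ n| ≤ 1) {κ : ℕ → (Fin (k + 1) → ℕ) → ℝ} (hκ : ∀ N y, 0 ≤ κ N y)
    (hκ1 : ∀ N, HasSum (κ N) 1) {ξ : ℕ → (Fin (k + 1) → ℕ) → Fin (k + 1) → ℝ}
    (hξ : ∀ N y i, 0 ≤ ξ N y i)
    (hs : ∀ (n : Fin (k + 1) → ℕ) (N : ℕ), Summable fun y => κ N y * ∏ j, linForm u j (ξ N y) ^ n j)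
    (hlim : ∀ n : Fin (k + 1) → ℕ, Tendsto (fun N => ∑' y, κ N y * ∏ j, linForm u j (ξ N y) ^ n j) atTop
      (𝓝 (ρ n))) : HasMomentRepresentation u ρ := by
  classical
  have hT (N : ℕ) (y : Fin (k + 1) → ℕ) : simplexRetract (ξ N y) ∈ unitSimplex k :=
    simplexRetract_mem (hξ N y)
  have hsT (n : Fin (k + 1) → ℕ) (N : ℕ) :
      Summable fun y => κ N y * ∏ j, linForm u j (simplexRetract (ξ N y)) ^ n j := by
    refine Summable.of_norm_bounded (hκ1 N).summable fun y => ?_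
    rw [norm_mul, Real.norm_of_nonneg (hκ N y)]
    exact mul_le_of_le_one_right (hκ N y) (abs_prod_linForm_le_one hu (hT N y) n)
  have htot (r : ℕ) (ζ : Fin (k + 1) → ℝ) :
      ∏ j, linForm u j ζ ^ (Pi.single 0 r : Fin (k + 1) → ℕ) j = total ζ ^ r := by
    rw [Finset.prod_eq_single 0]
    · simp [linForm, hu0, total]
    · intro j _ hj
      simp [hj]
    · simp
  have hlimT (n : Fin (k + 1) → ℕ) :
      Tendsto (fun N => ∑' y, κ N y * ∏ j, linForm u j (simplexRetract (ξ N y)) ^ n j) atTop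
        (𝓝 (ρ n)) := by
    have hdiff : Tendsto (fun N =>
        ∑' y, κ N y * ∏ j, linForm u j (simplexRetract (ξ N y)) ^ n j -
          ∑' y, κ N y * ∏ j, linForm u j (ξ N y) ^ n j) atTop (𝓝 0) := by
      rw [Metric.tendsto_nhds]
      intro ε hε
      -- The moment of |ξ| of order |n|m converges to an entry of `ρ`, which is at most 1, so it is
      -- eventually below 2 and the error is below 2/m < ε.
      obtain ⟨m, hm⟩ := exists_nat_gt (2 / ε)
      have hm0 : (0 : ℝ) < m := (by positivity : 0 < 2 / ε).trans hm
      have hev := (hlim (Pi.single 0 (size n * m))).eventually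
        (gt_mem_nhds (((abs_le.1 (hρ (Pi.single 0 (size n * m)))).2).trans_lt one_lt_two))
      filter_upwards [hev] with N hN
      have hsN := hs (Pi.single 0 (size n * m)) N
      simp only [htot] at hN hsN
      rw [Real.dist_eq, sub_zero, ← (hsT n N).tsum_sub (hs n N), ← Real.norm_eq_abs]
      have hb : ∀ y, ‖κ N y * ∏ j, linForm u j (simplexRetract (ξ N y)) ^ n j -
          κ N y * ∏ j, linForm u j (ξ N y) ^ n j‖
          ≤ (m : ℝ)⁻¹ * (κ N y * total (ξ N y) ^ (size n * m)) := by
        intro y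
        rw [← mul_sub, norm_mul, Real.norm_of_nonneg (hκ N y), mul_left_comm]
        exact mul_le_mul_of_nonneg_left (abs_prod_linForm_simplexRetract_sub_le hu (hξ N y) n
          (by exact_mod_cast hm0)) (hκ N y)
      refine (tsum_of_norm_bounded (hsN.hasSum.mul_left _) hb).trans_lt ?_
      rw [inv_mul_lt_iff₀ hm0]
      rw [div_lt_iff₀ hε] at hm
      linarith
    simpa using hdiff.add (hlim n)
  have hcomp : CompactSpace (unitSimplex k) := isCompact_iff_compactSpace.1 (isCompact_unitSimplex k)
  let P : ℕ → PMF (Fin (k + 1) → ℕ) := fun N => ⟨fun y => ENNReal.ofReal (κ N y), by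
    rw [ENNReal.summable.hasSum_iff, ← ENNReal.ofReal_tsum_of_nonneg (hκ N) (hκ1 N).summable,
      (hκ1 N).tsum_eq, ENNReal.ofReal_one]⟩
  let T : ℕ → (Fin (k + 1) → ℕ) → unitSimplex k := fun N y => ⟨simplexRetract (ξ N y), hT N y⟩
  have hTm (N : ℕ) : Measurable (T N) := measurable_of_countable _
  let ν : ℕ → ProbabilityMeasure (unitSimplex k) := fun N =>
    ⟨(P N).toMeasure.map (T N), Measure.isProbabilityMeasure_map (hTm N).aemeasurable⟩
  -- Probability measures on a compact space form a compact space, so an ultrafilter limit exists;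
  -- it replaces a convergent subsequence.
  let L := ((hyperfilter ℕ).map ν).lim
  have hL : Tendsto ν (hyperfilter ℕ) (𝓝 L) := ((hyperfilter ℕ).map ν).le_nhds_lim
  rw [ProbabilityMeasure.tendsto_iff_forall_integral_tendsto] at hL
  have hcont (n : Fin (k + 1) → ℕ) :
      Continuous fun ζ : unitSimplex k => ∏ j, linForm u j (ζ : Fin (k + 1) → ℝ) ^ n j := by
    have := continuous_linForm u
    fun_prop
  refine ⟨(L : Measure (unitSimplex k)).map Subtype.val,
    Measure.isProbabilityMeasure_map measurable_subtype_coe.aemeasurable, ?_, fun n => ?_⟩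
  · exact (ae_map_iff (p := fun ζ => ζ ∈ unitSimplex k) measurable_subtype_coe.aemeasurable
      (isCompact_unitSimplex k).measurableSet).2 (.of_forall fun ζ => ζ.2)
  · have h1 := hL (BoundedContinuousFunction.mkOfCompact ⟨_, hcont n⟩)
    have h2 (N : ℕ) : ∫ ζ : unitSimplex k, ∏ j, linForm u j (ζ : Fin (k + 1) → ℝ) ^ n j
        ∂(ν N : Measure (unitSimplex k))
        = ∑' y, κ N y * ∏ j, linForm u j (simplexRetract (ξ N y)) ^ n j := by
      change ∫ ζ, _ ∂((P N).toMeasure.map (T N)) = _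
      rw [integral_map (hTm N).aemeasurable (hcont n).aestronglyMeasurable, PMF.integral_eq_tsum]
      · refine tsum_congr fun y => ?_
        change (ENNReal.ofReal (κ N y)).toReal • _ = _
        rw [ENNReal.toReal_ofReal (hκ N y), smul_eq_mul]
      · refine Integrable.of_bound (Measurable.aestronglyMeasurable (measurable_of_countable _)) 1
          (.of_forall fun y => ?_)
        exact abs_prod_linForm_le_one hu (hT N y) n
    have h3 : Tendsto (fun N => ∫ ζ : unitSimplex k,
        ∏ j, linForm u j (ζ : Fin (k + 1) → ℝ) ^ n j ∂(ν N : Measure (unitSimplex k))) (hyperfilter ℕ) (𝓝 (ρ n)) := by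
      simp only [h2]
      exact (hlimT n).mono_left (Nat.hyperfilter_le_atTop)
    rw [integral_map measurable_subtype_coe.aemeasurable]
    · exact tendsto_nhds_unique h3 h1
    · have := continuous_linForm u
      exact Continuous.aestronglyMeasurable (by fun_prop)

end Limit

/-! ### Moments of the conditional law and the necessity of the representation. -/

section Moments

variable {k : ℕ} {μ : Fin (k + 1) → ℝ} {u : Fin (k + 1) → Fin (k + 1) → ℝ} {e : Fin (k + 1)}
  {ρ : (Fin (k + 1) → ℕ) → ℝ}

theorem SameLeading.exists_abs_sub_le {r : ℕ} {f g : (Fin (k + 1) → ℕ) → ℝ}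
    (h : SameLeading (r + 1) f g) :
    ∃ C, 0 ≤ C ∧ ∀ y, |f y - g y| ≤ C * growthWeight y ^ r := by
  obtain ⟨C, hC⟩ := isBigO_top.1 h.diff
  refine ⟨max C 0, le_max_right _ _, fun y => ?_⟩
  have h1 := hC y
  have h2 := growthWeight_pos y
  rw [norm_mul, norm_pow, Real.norm_of_nonneg h2.le, pow_succ, ← mul_assoc, Real.norm_eq_abs] at h1
  exact (le_of_mul_le_mul_right h1 h2).trans
    (mul_le_mul_of_nonneg_right (le_max_left _ _) (by positivity))

variable {K : (Fin (k + 1) → ℕ) → (Fin (k + 1) → ℕ) → ℝ}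

/-- C_n may be traded for its leading term g inside the kernel at the cost of a moment of one order
less, which is what drives the induction on the order. -/
theorem exists_moment_sub_le (hK0 : ∀ x y, 0 ≤ K x y)
    {n : Fin (k + 1) → ℕ} {r : ℕ} {c : ℝ} {g : (Fin (k + 1) → ℕ) → ℝ}
    (hK : ∀ x, HasSum (fun y => K x y * mvCharlier μ u n y) (c * mvCharlier μ u n x))
    (hg : SameLeading (r + 1) (mvCharlier μ u n) g) {A : ℝ}
    (hA : ∀ x, Summable (fun y => K x y * growthWeight y ^ r) ∧
      ∑' y, K x y * growthWeight y ^ r ≤ A * growthWeight x ^ r) :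
    ∃ C, 0 ≤ C ∧ ∀ x, Summable (fun y => K x y * g y) ∧
      |∑' y, K x y * g y - c * mvCharlier μ u n x| ≤ C * (A * growthWeight x ^ r) := by
  obtain ⟨C, hC0, hC⟩ := hg.exists_abs_sub_le
  refine ⟨C, hC0, fun x => ?_⟩
  have hb : ∀ y, ‖K x y * (mvCharlier μ u n y - g y)‖ ≤ C * (K x y * growthWeight y ^ r) := by
    intro y
    rw [norm_mul, Real.norm_of_nonneg (hK0 x y), mul_left_comm]
    exact mul_le_mul_of_nonneg_left (hC y) (hK0 x y)
  have hs := Summable.of_norm_bounded ((hA x).1.mul_left C) hb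
  have h1 := (hK x).sub hs.hasSum
  have h2 : HasSum (fun y => K x y * g y) (c * mvCharlier μ u n x -
      ∑' y, K x y * (mvCharlier μ u n y - g y)) :=
    (hasSum_congr_fun fun y => by ring).2 h1
  refine ⟨h2.summable, ?_⟩
  rw [h2.tsum_eq, sub_sub_cancel_left, abs_neg, ← Real.norm_eq_abs]
  exact (tsum_of_norm_bounded ((hA x).1.hasSum.mul_left C) hb).trans
    (mul_le_mul_of_nonneg_left (hA x).2 hC0)

/-- Moments of a kernel with eigenfunctions `C_n` and bounded eigenvalues. -/
theorem exists_moment_le (hμ : ∀ i, 0 < μ i) (hu : ∀ i, u 0 i = 1) (hρ0 : ρ 0 = 1)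
    (hρ : ∀ n, |ρ n| ≤ 1) (hK0 : ∀ x y, 0 ≤ K x y)
    (hK : ∀ n x, HasSum (fun y => K x y * mvCharlier μ u n y) (ρ n * mvCharlier μ u n x)) (r : ℕ) :
    ∃ A, 0 ≤ A ∧ ∀ x, Summable (fun y => K x y * growthWeight y ^ r) ∧
      ∑' y, K x y * growthWeight y ^ r ≤ A * growthWeight x ^ r := by
  induction r with
  | zero =>
    refine ⟨1, zero_le_one, fun x => ?_⟩
    have h := hK 0 x
    simp only [mvCharlier_zero μ hu, hρ0, mul_one] at h
    simp only [pow_zero, mul_one]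
    exact ⟨h.summable, h.tsum_eq.le⟩
  | succ r ih =>
    obtain ⟨A, hA0, hA⟩ := ih
    -- For this index the leading term is a multiple of |y|^{r+1}, so its eigenfunction relation
    -- controls the moment of order r + 1.
    set n : Fin (k + 1) → ℕ := Pi.single 0 (r + 1) with hn
    have hsize : size n = r + 1 := by simp [size, hn]
    have hprod (y : Fin (k + 1) → ℕ) : ∏ l, countForm u l y ^ n l = (size y : ℝ) ^ (r + 1) := by
      rw [Finset.prod_eq_single 0]
      · simp [countForm, linForm, hu, size, hn]
      · intro j _ hj
        simp [hn, hj]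
      · simp
    have h1 := SameLeading.mvCharlier μ hu n
    simp only [hprod, hsize] at h1
    have h2 := h1.trans ((SameLeading.size_growthWeight.pow (r + 1)).const_mul (leadCoeff μ n))
    obtain ⟨C, hC0, hC⟩ := exists_moment_sub_le hK0 (hK n) h2 hA
    obtain ⟨B, hB⟩ := isBigO_top.1 h2.left
    have hβ := abs_pos.2 (leadCoeff_ne_zero hμ n)
    have hB0 : 0 ≤ B := by
      have h := hB 0
      rw [show growthWeight (0 : Fin (k + 1) → ℕ) = 1 by simp [growthWeight, size]] at h
      simpa using (norm_nonneg _).trans h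
    refine ⟨|leadCoeff μ n|⁻¹ * (B + C * A), by positivity, fun x => ?_⟩
    obtain ⟨h3, h4⟩ := hC x
    have h5 : Summable fun y => K x y * growthWeight y ^ (r + 1) := by
      refine (h3.mul_left (leadCoeff μ n)⁻¹).congr fun y => ?_
      have := leadCoeff_ne_zero hμ n
      field_simp
    refine ⟨h5, ?_⟩
    have hW := one_le_growthWeight x
    have hW0 := growthWeight_pos x
    have h6 : ∑' y, K x y * (leadCoeff μ n * growthWeight y ^ (r + 1))
        = leadCoeff μ n * ∑' y, K x y * growthWeight y ^ (r + 1) := by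
      rw [← tsum_mul_left]
      exact tsum_congr fun y => by ring
    have h7 : |ρ n * mvCharlier μ u n x| ≤ B * growthWeight x ^ (r + 1) := by
      rw [abs_mul]
      have := hB x
      rw [Real.norm_eq_abs, Real.norm_of_nonneg (by positivity)] at this
      exact (mul_le_of_le_one_left (abs_nonneg _) (hρ n)).trans this
    have h8 : C * (A * growthWeight x ^ r) ≤ C * A * growthWeight x ^ (r + 1) := by
      rw [← mul_assoc]
      exact mul_le_mul_of_nonneg_left (pow_le_pow_right₀ hW (Nat.le_succ r)) (by positivity)
    have h9 : 0 ≤ ∑' y, K x y * growthWeight y ^ (r + 1) := tsum_nonneg fun y =>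
      mul_nonneg (hK0 x y) (pow_nonneg (growthWeight_pos y).le _)
    rw [h6] at h4
    have h10 : |leadCoeff μ n| * ∑' y, K x y * growthWeight y ^ (r + 1)
        ≤ (B + C * A) * growthWeight x ^ (r + 1) := by
      rw [← abs_of_nonneg h9, ← abs_mul]
      have h11 := abs_sub_abs_le_abs_sub
        (leadCoeff μ n * ∑' y, K x y * growthWeight y ^ (r + 1)) (ρ n * mvCharlier μ u n x)
      linarith
    rw [mul_assoc, inv_mul_eq_div, le_div_iff₀ hβ]
    linarith

theorem growthWeight_single (e : Fin (k + 1)) (N : ℕ) :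
    growthWeight (Pi.single e N) = 1 + N := by
  simp [growthWeight, size]

/-- The moments of the rescaled kernel started far out in the direction `e` converge to the
eigenvalues. -/
theorem tendsto_moment (hμ : ∀ i, 0 < μ i) (hu : ∀ i, u 0 i = 1) (hue : ∀ r, u r e = 1)
    (hρ0 : ρ 0 = 1) (hρ : ∀ n, |ρ n| ≤ 1) (hK0 : ∀ x y, 0 ≤ K x y)
    (hK : ∀ n x, HasSum (fun y => K x y * mvCharlier μ u n y) (ρ n * mvCharlier μ u n x))
    (n : Fin (k + 1) → ℕ) :
    (∀ N : ℕ, Summable fun y => K (Pi.single e (N + 1)) y *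
      ∏ j, linForm u j (((N : ℝ) + 1)⁻¹ • fun i => (y i : ℝ)) ^ n j) ∧
    Tendsto (fun N : ℕ => ∑' y, K (Pi.single e (N + 1)) y *
      ∏ j, linForm u j (((N : ℝ) + 1)⁻¹ • fun i => (y i : ℝ)) ^ n j) atTop (𝓝 (ρ n)) := by
  have hone : ∀ x, HasSum (K x) 1 := fun x => by
    simpa [mvCharlier_zero μ hu, hρ0] using hK 0 x
  have hscale (N : ℕ) (y : Fin (k + 1) → ℕ) :
      ∏ j, linForm u j (((N : ℝ) + 1)⁻¹ • fun i => (y i : ℝ)) ^ n j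
        = (((N : ℝ) + 1)⁻¹) ^ size n * ∏ l, countForm u l y ^ n l :=
    prod_linForm_smul u _ _ n
  simp only [hscale]
  rcases hr : size n with _ | r
  · have hn : n = 0 := funext fun l => (Finset.sum_eq_zero_iff.1 hr) l (Finset.mem_univ l)
    subst hn
    simp only [pow_zero, Pi.zero_apply, Finset.prod_const_one, mul_one, (hone _).tsum_eq, hρ0]
    exact ⟨fun N => (hone _).summable, tendsto_const_nhds⟩
  · obtain ⟨A, hA0, hA⟩ := exists_moment_le hμ hu hρ0 hρ hK0 hK r
    have h1 := SameLeading.mvCharlier μ hu n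
    rw [hr] at h1
    obtain ⟨C, hC0, hC⟩ := exists_moment_sub_le hK0 (hK n) h1 hA
    obtain ⟨B, hB0, hB⟩ := h1.exists_abs_sub_le
    have hβ := leadCoeff_ne_zero hμ n
    have hs : ∀ x, Summable fun y => K x y * ∏ l, countForm u l y ^ n l := fun x => by
      refine ((hC x).1.mul_left (leadCoeff μ n)⁻¹).congr fun y => ?_
      field_simp
    have hcomm (N : ℕ) (y : Fin (k + 1) → ℕ) : K (Pi.single e (N + 1)) y *
        ((((N : ℝ) + 1)⁻¹) ^ (r + 1) * ∏ l, countForm u l y ^ n l)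
        = (((N : ℝ) + 1)⁻¹) ^ (r + 1) *
          (K (Pi.single e (N + 1)) y * ∏ l, countForm u l y ^ n l) := by ring
    simp only [hcomm, tsum_mul_left]
    refine ⟨fun N => (hs _).mul_left _, ?_⟩
    set D : ℝ := |leadCoeff μ n|⁻¹ * (C * A + B) * 2 ^ r with hD
    have hlim0 : Tendsto (fun N : ℕ => D * (1 / ((N : ℝ) + 1))) atTop (𝓝 0) := by
      simpa using tendsto_one_div_add_atTop_nhds_zero_nat.const_mul D
    rw [tendsto_iff_dist_tendsto_zero]
    refine squeeze_zero (fun _ => dist_nonneg) (fun N => ?_) hlim0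
    set x : Fin (k + 1) → ℕ := Pi.single e (N + 1) with hx
    set t : ℝ := (N : ℝ) + 1 with ht
    have ht1 : 1 ≤ t := by rw [ht]; linarith [(Nat.cast_nonneg N : (0 : ℝ) ≤ N)]
    have ht0 : 0 < t := by linarith
    -- Here the scaling u_e^{(l)} = 1 enters: far out in the direction e all linear forms take the
    -- same value. Starting at N + 1 rather than N keeps the scale positive.
    have hform : ∏ l, countForm u l x ^ n l = t ^ (r + 1) := by
      have h2 (l : Fin (k + 1)) : countForm u l x = t := by
        rw [countForm, linForm, Finset.sum_eq_single e]
        · simp [hx, hue, ht]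
        · intro i _ hi
          simp [hx, hi]
        · simp
      simp only [h2, Finset.prod_pow_eq_pow_sum]
      rw [← hr, size]
    have hw : growthWeight x ≤ 2 * t := by
      rw [hx, growthWeight_single]
      push_cast
      linarith
    have hwr : growthWeight x ^ r ≤ 2 ^ r * t ^ r := by
      rw [← mul_pow]
      exact pow_le_pow_left₀ (growthWeight_pos x).le hw r
    set M : ℝ := ∑' y, K x y * ∏ l, countForm u l y ^ n l with hM
    have h3 : ∑' y, K x y * (leadCoeff μ n * ∏ l, countForm u l y ^ n l) = leadCoeff μ n * M := by
      rw [hM, ← tsum_mul_left]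
      exact tsum_congr fun y => by ring
    have h4 := (hC x).2
    have h5 := hB x
    rw [h3] at h4
    rw [hform] at h5
    have h6 : |ρ n * (mvCharlier μ u n x - leadCoeff μ n * t ^ (r + 1))|
        ≤ B * growthWeight x ^ r := by
      rw [abs_mul]
      exact (mul_le_of_le_one_left (abs_nonneg _) (hρ n)).trans h5
    have h7 : |leadCoeff μ n| * |M - ρ n * t ^ (r + 1)| ≤ (C * A + B) * (2 ^ r * t ^ r) := by
      rw [← abs_mul, show leadCoeff μ n * (M - ρ n * t ^ (r + 1))
        = (leadCoeff μ n * M - ρ n * mvCharlier μ u n x)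
          + ρ n * (mvCharlier μ u n x - leadCoeff μ n * t ^ (r + 1)) by ring]
      refine (abs_add_le _ _).trans ((add_le_add h4 h6).trans ?_)
      rw [← mul_assoc, ← add_mul]
      exact mul_le_mul_of_nonneg_left hwr (by positivity)
    have h8 : |M - ρ n * t ^ (r + 1)| ≤ D * t ^ r := by
      rw [hD, mul_assoc, mul_assoc, inv_mul_eq_div, le_div_iff₀ (abs_pos.2 hβ)]
      linarith
    rw [Real.dist_eq, show t⁻¹ ^ (r + 1) * M - ρ n = t⁻¹ ^ (r + 1) * (M - ρ n * t ^ (r + 1)) by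
      rw [mul_sub, mul_left_comm, ← mul_pow, inv_mul_cancel₀ ht0.ne', one_pow, mul_one], abs_mul,
      abs_of_pos (by positivity)]
    refine (mul_le_mul_of_nonneg_left h8 (by positivity)).trans (le_of_eq ?_)
    rw [pow_succ, one_div, inv_pow]
    field_simp

/-- A mean square convergent non-negative expansion has a representable array. -/
theorem hasMomentRepresentation_of_nonneg (hμ : ∀ i, 0 < μ i)
    (hu : IsOrthogonalBasis (prob μ) u e) (hyper : HypergroupProperty (prob μ) u)
    (hρ0 : ρ 0 = 1) (hms : ConvergesInMeanSquare μ u ρ) (h0 : ∀ x y, 0 ≤ expansion μ u ρ x y) :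
    HasMomentRepresentation u ρ := by
  have hρ := (isBivariatePoisson_of_nonneg hμ hu hρ0 hms h0).abs_le_one hμ hu
  have hK0 : ∀ x y, 0 ≤ (poissonProb μ x)⁻¹ * expansion μ u ρ x y := fun x y =>
    mul_nonneg (inv_pos.2 (poissonProb_pos hμ x)).le (h0 x y)
  have hK : ∀ n x, HasSum (fun y => (poissonProb μ x)⁻¹ * expansion μ u ρ x y *
      mvCharlier μ u n y) (ρ n * mvCharlier μ u n x) := fun n x => by
    have h := (hms.hasSum_mvCharlier_mul_expansion hμ hu hρ0 n x).mul_left (poissonProb μ x)⁻¹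
    rw [inv_mul_cancel_left₀ (poissonProb_pos hμ x).ne'] at h
    exact (hasSum_congr_fun fun y => by ring).2 h
  have hmom := tendsto_moment hμ hu.zero_eq_one hu.scaled hρ0 hρ hK0 hK
  refine hasMomentRepresentation_of_tendsto (hyper.abs_le_one hu (prob_pos hμ)) hu.zero_eq_one hρ
    (κ := fun N y => (poissonProb μ (Pi.single e (N + 1)))⁻¹ *
      expansion μ u ρ (Pi.single e (N + 1)) y) (fun N y => hK0 _ y) (fun N => ?_)
    (ξ := fun N y => ((N : ℝ) + 1)⁻¹ • fun i => (y i : ℝ)) (fun N y i => ?_)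
    (fun n => (hmom n).1) (fun n => (hmom n).2)
  · simpa [mvCharlier_zero μ hu.zero_eq_one, hρ0] using hK 0 (Pi.single e (N + 1))
  · simp only [Pi.smul_apply, smul_eq_mul]
    positivity

end Moments

end PoissonLancaster

end

open PoissonLancaster
theorem theorem3 (k : ℕ) (μ : Fin (k + 1) → ℝ) (hμ : ∀ i, 0 < μ i)
    (u : Fin (k + 1) → Fin (k + 1) → ℝ) (e : Fin (k + 1))
    (hu : IsOrthogonalBasis (prob μ) u e)
    (hyper : HypergroupProperty (prob μ) u)
    (ρ : (Fin (k + 1) → ℕ) → ℝ) (hρ : ρ 0 = 1) :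
    ((ConvergesInMeanSquare μ u ρ ∧ ∀ x y, 0 ≤ expansion μ u ρ x y) ↔
      HasMomentRepresentation u ρ) ∧
    (IsBivariatePoisson μ u ρ ↔ HasMomentRepresentation u ρ) ∧
    ((∃ K : ℝ, ∀ n, |ρ n| ≤ K) → ConvergesInMeanSquare μ u ρ) := by
  have hbound : ∀ K : ℝ, (∀ n, |ρ n| ≤ K) → ConvergesInMeanSquare μ u ρ := fun K hK =>
    convergesInMeanSquare_of_bounded hμ hu hK
  have hrep : HasMomentRepresentation u ρ →
      ConvergesInMeanSquare μ u ρ ∧ ∀ x y, 0 ≤ expansion μ u ρ x y := fun h =>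
    ⟨hbound 1 (h.abs_le_one (hyper.abs_le_one hu (prob_pos hμ))),
      h.expansion_nonneg hμ hu hyper hρ⟩
  refine ⟨⟨fun h => hasMomentRepresentation_of_nonneg hμ hu hyper hρ h.1 h.2, hrep⟩,
    ⟨fun h => ?_, fun h => ?_⟩, fun ⟨K, hK⟩ => hbound K hK⟩
  -- A genuine bivariate Poisson distribution has |ρ_n| ≤ 1, so mean-square convergence is automatic
  -- and (a) applies.
  · exact hasMomentRepresentation_of_nonneg hμ hu hyper hρ (hbound 1 (h.abs_le_one hμ hu)) h.nonneg
  · exact isBivariatePoisson_of_nonneg hμ hu hρ (hrep h).1 (hrep h).2
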